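/- Let $N,K\ge 1$, $s\ge 0$. For $1\le k\le K$ let $E_k$ be a real Banach space (energy space, e.g. $H^1(\mathbb R^N)$), continuously and densely embedded in $L^2(\mathbb R^N;\mathbb R)$, so that $E_k\subset L^2\subset E_k^*$; put $X=\prod_k E_k$, $Y=\prod_k E_k^*$, and let $\langle\cdot,\cdot\rangle$ be the $L^2$ inner product. Let $\mathbf M=\mathrm{diag}(M_1,\dots,M_K)$, where each $M_k:E_k\to E_k^*$ is a Hermitian, positive definite isomorphism. For $\mathbf L_{00}:X\to Y$ and real $\mu=(\mu_1,\dots,\mu_K)$ consider $$\mathbf L_0\mathbf u\equiv \mathbf L_{00}\mathbf u-\mathrm{diag}(\mu_1,\dots,\mu_K)\mathbf u=0,$$ and let $\mathbf L_1:X\to Y$ be the linearization (Fréchet derivative) of $\mathbf L_0$ at $\mathbf u$ and $\mathbf L_1^\dagger$ its Hermitian adjoint. Let $\mathbf u(\cdot;\mu,c)\in X$ be a $C^1$ family of solutions, with $(\mu,c)$ in an open subset $U$ of $\mathbb R^K\times\mathbb R^s$ (the $\mu_k$ are independent; $c=(c_1,\dots,c_s)$ are the free parameters of the solution). Fix $(\mu,c)\in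 U$, write $\mathbf u=\mathbf u(\cdot;\mu,c)$, $P_k=\langle u_k,u_k\rangle$, and suppose that $\mathbf L_{00}$ is $C^2$ near $\mathbf u$. Assume: (i) the kernel of $\mathbf L_1$ at $\mathbf u$ is spanned by the invariance modes $\partial\mathbf u/\partial c_j$, $1\le j\le s$ (Assumption 1), and the range of $\mathbf L_1$ is closed in $Y$ (zero does not belong to its continuous spectrum); (ii) the solutions $\mathbf u(\cdot;\mu,d)$, $(\mu,d)\in U$, are orthogonal to the kernel of their linearized operator $\mathbf L_1$, component by component: $\langle u_k(\cdot;\mu,d),\psi_k\rangle=0$ for all $k$ and all $\psi\in\ker\mathbf L_1$; (iii) $\det(\partial P_i/\partial\mu_j)\ne0$ at $(\mu,c)$. For $f\in Y$ put $a_k(\mathbf u;f)=\langle u_k,[\mathbf M^{-1}f]_k\rangle/\langle u_k,M_k^{-1}u_k\rangle$. The power-conserving squared-operator method (PCSOM) with time step $\Delta t>0$ is $$u_{k,n+1}=\Big[\frac{P_k}{\langle\hat u_{k,n+1},\hat u_{k,n+1}\rangle}\Big]^{1/2}\hat u_{k,n+1},\qquad \hat{\mathbf u}_{n+1}=\mathbf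 u_n-\mathbf M^{-1}\big\{\mathbf L_1^\dagger\mathbf M^{-1}\mathbf L_0\mathbf u-\mathrm{diag}(\gamma_1,\dots,\gamma_K)\mathbf u\big\}_{\mathbf u=\mathbf u_n,\ \mu_k=\mu_{k,n}}\Delta t,$$ with $\mu_{k,n}=a_k(\mathbf u_n;\mathbf L_{00}\mathbf u_n)$ and $\gamma_k=a_k(\mathbf u;\mathbf L_1^\dagger\mathbf M^{-1}\mathbf L_0\mathbf u)$ evaluated in the same way. At the solution $\mathbf u$ define on $X$ the bounded operators $$\mathcal L_{PCV}\Psi=\mathbf M^{-1}\{\hat{\mathbf L}_V\Psi-\mathrm{diag}(\hat\gamma_1,\dots,\hat\gamma_K)\mathbf u\},\qquad \hat{\mathbf L}_V\Psi=-\mathbf L_1^\dagger\mathbf M^{-1}[\mathbf L_1\Psi-\mathrm{diag}(\beta_1,\dots,\beta_K)\mathbf u],$$ with $\hat\gamma_k=a_k(\mathbf u;\hat{\mathbf L}_V\Psi)$, $\beta_k=a_k(\mathbf u;\mathbf L_1\Psi)$; let $\Lambda_{\min}$ be the minimum of the spectrum of $\mathcal L_{PCV}$ and $\Delta t_{\max}=-2/\Lambda_{\min}$.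 Then: (a) If $\Delta t<\Delta t_{\max}$, the PCSOM converges to the solitary wave with component powers $P_1,\dots,P_K$, up to a small shift of the free parameters $c$, whenever the initial condition is close to $\mathbf u$: for every $\varepsilon>0$ there is $\delta>0$ such that for every $\mathbf u_0\in X$ with $\|\mathbf u_0-\mathbf u\|_X<\delta$ all iterates are well defined and stay within distance $\varepsilon$ of $\mathbf u$, and $\mathbf u_n\to\mathbf u(\cdot;\mu,d)$ in $X$ for some $d$ with $|d-c|<\varepsilon$, $(\mu,d)\in U$, where $\mathbf u(\cdot;\mu,d)$ has the component powers $P_1,\dots,P_K$. (b) If $\Delta t>\Delta t_{\max}$, the PCSOM diverges from $\mathbf u$: there is $\varepsilon>0$ such that arbitrarily close to $\mathbf u$ there are initial conditions whose (well-defined) iterates reach distance at least $\varepsilon$ from $\mathbf u$. -/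

import Mathlib

open Filter Topology

namespace PCSOM

/-- Real square-integrable functions on `ℝ^N`, with the `L²` inner product. -/
abbrev L2 (N : ℕ) : Type :=
  MeasureTheory.Lp ℝ 2 (MeasureTheory.volume : MeasureTheory.Measure (EuclideanSpace ℝ (Fin N)))

/-- A `K`-component wave `u = (u_1, …, u_K)`; the component `u_k` lies in the energy space `E k`,
a Banach space that is continuously embedded in `L²(ℝ^N)`, for example `H¹(ℝ^N)`. -/
abbrev State {K : ℕ} (E : Fin K → Type*) : Type _ := ∀ k, E k

/-- The values of the differential operators, for example elements of `H⁻¹(ℝ^N)^K`. -/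
abbrev CoState {K : ℕ} (E : Fin K → Type*) [∀ k, NormedAddCommGroup (E k)]
    [∀ k, NormedSpace ℝ (E k)] : Type _ := ∀ k, StrongDual ℝ (E k)

noncomputable section

variable {N K : ℕ} {E : Fin K → Type*} [∀ k, NormedAddCommGroup (E k)] [∀ k, NormedSpace ℝ (E k)]

/-- The `L²` inner product `⟨u_k, v_k⟩` of the `k`-th components. -/
def ip (ι : ∀ k, E k →L[ℝ] L2 N) (k : Fin K) (a b : E k) : ℝ :=
  inner ℝ (ι k a) (ι k b)

/-- The power `⟨u_k, u_k⟩` of the `k`-th component. -/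
def power (ι : ∀ k, E k →L[ℝ] L2 N) (u : State E) (k : Fin K) : ℝ := ip ι k (u k) (u k)

/-- The inclusion `E k ⊂ L² ⊂ (E k)*`, `a ↦ ⟨a, ·⟩`. -/
def toDual (ι : ∀ k, E k →L[ℝ] L2 N) (k : Fin K) : E k →L[ℝ] StrongDual ℝ (E k) :=
  (innerSL ℝ).bilinearComp (ι k) (ι k)

/-- `u ↦ diag(μ_1, …, μ_K) u`. -/
def diagOp (ι : ∀ k, E k →L[ℝ] L2 N) (μ : Fin K → ℝ) : State E →L[ℝ] CoState E :=
  ContinuousLinearMap.pi fun k => μ k • (toDual ι k).comp (ContinuousLinearMap.proj k)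

/-- `L₀ u = L₀₀ u - diag(μ_1, …, μ_K) u`. -/
def L0 (ι : ∀ k, E k →L[ℝ] L2 N) (L00 : State E → CoState E) (μ : Fin K → ℝ) (u : State E) :
    CoState E := L00 u - diagOp ι μ u

/-- The linearization `L₁` of `L₀` at `u`. -/
def L1 (ι : ∀ k, E k →L[ℝ] L2 N) (L00 : State E → CoState E) (μ : Fin K → ℝ) (u : State E) :
    State E →L[ℝ] CoState E := fderiv ℝ (L0 ι L00 μ) u

/-- The Hermitian adjoint `A†`: `∑_k [A† w]_k (v_k) = ∑_j [A v]_j (w_j)`. -/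
def adj (A : State E →L[ℝ] CoState E) : State E →L[ℝ] CoState E :=
  ContinuousLinearMap.pi fun k => ∑ j,
    (((ContinuousLinearMap.proj j).comp A).comp
      (ContinuousLinearMap.single ℝ E k)).flip.comp (ContinuousLinearMap.proj j)

/-- `M⁻¹` for `M = diag(M_1, …, M_K)`. -/
def Minv (M : ∀ k, E k ≃L[ℝ] StrongDual ℝ (E k)) : CoState E →L[ℝ] State E :=
  ContinuousLinearMap.pi fun k =>
    ((M k).symm : StrongDual ℝ (E k) →L[ℝ] E k).comp (ContinuousLinearMap.proj k)

/-- The quotient `⟨u_k, [M⁻¹ f]_k⟩ / ⟨u_k, M_k⁻¹ u_k⟩`, as a functional of `f`. -/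
def coeff (ι : ∀ k, E k →L[ℝ] L2 N) (M : ∀ k, E k ≃L[ℝ] StrongDual ℝ (E k)) (u : State E)
    (k : Fin K) : CoState E →L[ℝ] ℝ :=
  (ip ι k (u k) ((M k).symm (toDual ι k (u k))))⁻¹ •
    (toDual ι k (u k)).comp ((ContinuousLinearMap.proj k).comp (Minv M))

/-- `f ↦ diag(a_1, …, a_K) u`, where `a_k = ⟨u_k, [M⁻¹ f]_k⟩ / ⟨u_k, M_k⁻¹ u_k⟩`. -/
def coeffDiag (ι : ∀ k, E k →L[ℝ] L2 N) (M : ∀ k, E k ≃L[ℝ] StrongDual ℝ (E k)) (u : State E) :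
    CoState E →L[ℝ] CoState E :=
  ContinuousLinearMap.pi fun k => (coeff ι M u k).smulRight (toDual ι k (u k))

/-- `L̂_V Ψ = -L₁† M⁻¹ [L₁ Ψ - diag(β_1, …, β_K) u]`,
`β_k = ⟨u_k, [M⁻¹ L₁ Ψ]_k⟩ / ⟨u_k, M_k⁻¹ u_k⟩`. -/
def LhatV (ι : ∀ k, E k →L[ℝ] L2 N) (M : ∀ k, E k ≃L[ℝ] StrongDual ℝ (E k))
    (L00 : State E → CoState E) (μ : Fin K → ℝ) (u : State E) : State E →L[ℝ] CoState E :=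
  -(((adj (L1 ι L00 μ u)).comp (Minv M)).comp
    (L1 ι L00 μ u - (coeffDiag ι M u).comp (L1 ι L00 μ u)))

/-- `𝓛_PCV Ψ = M⁻¹ {L̂_V Ψ - diag(γ̂_1, …, γ̂_K) u}`,
`γ̂_k = ⟨u_k, [M⁻¹ L̂_V Ψ]_k⟩ / ⟨u_k, M_k⁻¹ u_k⟩`. -/
def LPCV (ι : ∀ k, E k →L[ℝ] L2 N) (M : ∀ k, E k ≃L[ℝ] StrongDual ℝ (E k))
    (L00 : State E → CoState E) (μ : Fin K → ℝ) (u : State E) : State E →L[ℝ] State E :=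
  (Minv M).comp (LhatV ι M L00 μ u - (coeffDiag ι M u).comp (LhatV ι M L00 μ u))

/-- `Λ_min`: the least point of the spectrum of `𝓛_PCV`. -/
def LambdaMin (ι : ∀ k, E k →L[ℝ] L2 N) (M : ∀ k, E k ≃L[ℝ] StrongDual ℝ (E k))
    (L00 : State E → CoState E) (μ : Fin K → ℝ) (u : State E) : ℝ :=
  sInf (spectrum ℝ (LPCV ι M L00 μ u))

/-- The propagation constants that the scheme assigns to an iterate `u`:
`μ_k = ⟨u_k, [M⁻¹ L₀₀ u]_k⟩ / ⟨u_k, M_k⁻¹ u_k⟩`. -/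
def muOf (ι : ∀ k, E k →L[ℝ] L2 N) (M : ∀ k, E k ≃L[ℝ] StrongDual ℝ (E k))
    (L00 : State E → CoState E) (u : State E) (k : Fin K) : ℝ := coeff ι M u k (L00 u)

/-- `L₁† M⁻¹ L₀ u` at the iterate `u`, with `μ_k` given by `muOf`. -/
def residual (ι : ∀ k, E k →L[ℝ] L2 N) (M : ∀ k, E k ≃L[ℝ] StrongDual ℝ (E k))
    (L00 : State E → CoState E) (u : State E) : CoState E :=
  adj (L1 ι L00 (muOf ι M L00 u) u) (Minv M (L0 ι L00 (muOf ι M L00 u) u))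

/-- `γ_k = ⟨u_k, [M⁻¹ L₁† M⁻¹ L₀ u]_k⟩ / ⟨u_k, M_k⁻¹ u_k⟩`. -/
def gammaOf (ι : ∀ k, E k →L[ℝ] L2 N) (M : ∀ k, E k ≃L[ℝ] StrongDual ℝ (E k))
    (L00 : State E → CoState E) (u : State E) (k : Fin K) : ℝ :=
  coeff ι M u k (residual ι M L00 u)

/-- `û = u - M⁻¹ {L₁† M⁻¹ L₀ u - diag(γ_1, …, γ_K) u} Δt`. -/
def hatStep (ι : ∀ k, E k →L[ℝ] L2 N) (M : ∀ k, E k ≃L[ℝ] StrongDual ℝ (E k))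
    (L00 : State E → CoState E) (Δt : ℝ) (u : State E) : State E :=
  u - Δt • Minv M (residual ι M L00 u - diagOp ι (gammaOf ι M L00 u) u)

/-- One step of the iteration with prescribed component powers `P_k`:
`u_k ↦ [P_k / ⟨û_k, û_k⟩]^{1/2} û_k`. -/
def step (ι : ∀ k, E k →L[ℝ] L2 N) (M : ∀ k, E k ≃L[ℝ] StrongDual ℝ (E k))
    (L00 : State E → CoState E) (P : Fin K → ℝ) (Δt : ℝ) (u : State E) : State E :=
  fun k => √(P k / power ι (hatStep ι M L00 Δt u) k) • hatStep ι M L00 Δt u k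

/-- All expressions in `step` make sense at `u`: `L₀₀` can be linearized at `u`, and no component
by whose norm one divides vanishes. -/
def StepDefined (ι : ∀ k, E k →L[ℝ] L2 N) (M : ∀ k, E k ≃L[ℝ] StrongDual ℝ (E k))
    (L00 : State E → CoState E) (Δt : ℝ) (u : State E) : Prop :=
  DifferentiableAt ℝ L00 u ∧ ∀ k, u k ≠ 0 ∧ hatStep ι M L00 Δt u k ≠ 0

/-- The `n`-th iterate `u_n` of the scheme started at `u₀`. -/
def iter (ι : ∀ k, E k →L[ℝ] L2 N) (M : ∀ k, E k ≃L[ℝ] StrongDual ℝ (E k))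
    (L00 : State E → CoState E) (P : Fin K → ℝ) (Δt : ℝ) (u₀ : State E) (n : ℕ) : State E :=
  (step ι M L00 P Δt)^[n] u₀

/-- The matrix `D = (∂P_i/∂μ_j)` of the family `φ (μ, c)` of waves, at `(μ, c)`. -/
def powerJacobian (ι : ∀ k, E k →L[ℝ] L2 N) {s : ℕ}
    (φ : (Fin K → ℝ) × (Fin s → ℝ) → State E) (μ : Fin K → ℝ) (c : Fin s → ℝ) :
    Matrix (Fin K) (Fin K) ℝ :=
  Matrix.of fun i j => fderiv ℝ (fun ν => power ι (φ (ν, c)) i) μ (Pi.single j 1)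

/-- The invariance mode `∂u/∂c_j` of the family `φ (μ, c)`. -/
def mode {s : ℕ} (φ : (Fin K → ℝ) × (Fin s → ℝ) → State E) (μ : Fin K → ℝ) (c : Fin s → ℝ)
    (j : Fin s) : State E :=
  fderiv ℝ (fun d => φ (μ, d)) c (Pi.single j 1)

end

end PCSOM

open PCSOM

/-! Since each `M k` is positive and an isomorphism, the energy form `∑ M_k a_k (b_k)` is coercive
and makes `X` a Hilbert space. Put `A = M⁻¹ L₁`; its adjoint there is `M⁻¹ L₁†`. Subtracting
`diag(a_k) u` in the dual becomes, after `M⁻¹`, the orthogonal projection `Q` onto the constraints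
`⟨u_k, x_k⟩ = 0`. Hence `𝓛_PCV = -Q A† Q A`, which on the range of `Q` is `-B† B` with `B = Q A Q`.
Its least spectral point is `-‖B‖²` (`isLeast_spectrum_neg_compression`), so `Δt_max = 2 / ‖B‖²`.
The scheme, linearized at the wave, maps into the range of `Q` and acts there as the Richardson
iteration `1 - Δt B† B`.

Convergence. Differentiating the wave equation in `μ_k` shows that `A` sends `∂u/∂μ_k` to the normal
of the `k`-th constraint. Together with the closed range of `A` and the nonvanishing Jacobian of the
powers this yields `‖B w‖ ≥ c ‖w‖` for constrained `w` orthogonal to the kernel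
(`exists_lower_bound_of_isClosed_range`). For `Δt ‖B‖² < 2` the linearization therefore contracts
modulo the kernel. The kernel is the tangent space of the waves `φ (μ, d)`; orthogonality to the
kernel keeps their powers constant in `d`, so they are fixed points of the same scheme. The iterates
are tracked by a moving base point on this family, whose shifts are summable
(`iterate_tendsto_fixed_manifold`).

Divergence. For `Δt ‖B‖² > 2` the growth rate `ρ = Δt ‖B‖² - 1` exceeds 1. It need not belong to an
eigenvector, but vectors that almost attain `‖B‖` are approximate eigenvectors, and their accuracy
can be adapted to the number of steps (`exists_seminorm_growth`). Because `T` has norm at most `ρ`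
in an equivalent norm and the nonlinear remainder is quadratic, the orbit follows the linear growth
up to a fixed distance (`exists_iterate_far`). -/

/-! ### Nonlinear dynamics near fixed points -/

theorem HasStrictFDerivAt.exists_ball_norm_le {X Y : Type*} [NormedAddCommGroup X]
    [NormedSpace ℝ X] [NormedAddCommGroup Y] [NormedSpace ℝ Y] {f : X → Y} {f' : X →L[ℝ] Y} {x : X}
    (h : HasStrictFDerivAt f f' x) {η : ℝ} (hη : 0 < η) :
    ∃ r > 0, ∀ a b, ‖a - x‖ < r → ‖b - x‖ < r → ‖f a - f b - f' (a - b)‖ ≤ η * ‖a - b‖ := by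
  have h1 := h.isLittleO.bound hη
  rw [Metric.eventually_nhds_iff] at h1
  obtain ⟨r, hr, h1⟩ := h1
  refine ⟨r, hr, fun a b ha hb => ?_⟩
  have := @h1 (a, b) (by
    rw [Prod.dist_eq, max_lt_iff, dist_eq_norm, dist_eq_norm]; exact ⟨ha, hb⟩)
  simpa using this

/-- One step of the tracking argument: `x = σ v + y` is mapped to `F x = σ v' + y'` with a
contracted remainder `y'`. -/
theorem tracking_step {X V : Type*} [NormedAddCommGroup X] [NormedSpace ℝ X]
    [NormedAddCommGroup V] [NormedSpace ℝ V] {F : X → X} {σ : V → X} {T : X →L[ℝ] X}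
    {S : V →L[ℝ] X} (R : X →L[ℝ] V) (p : Seminorm ℝ X) {cp Cp : ℝ} (hcp : 0 < cp) (hCp : 0 ≤ Cp)
    (hlow : ∀ x, cp * ‖x‖ ≤ p x) (hup : ∀ x, p x ≤ Cp * ‖x‖) {q : ℝ}
    (hcontr : ∀ x, p (T x - S (R (T x))) ≤ q * p x) {η : ℝ} (hη0 : 0 ≤ η)
    (hη1 : η ≤ 1) {x : X} {v : V} (hfix : F (σ v) = σ v)
    (hF : ‖F x - F (σ v) - T (x - σ v)‖ ≤ η * ‖x - σ v‖)
    (hσ : ‖σ (v + R (F x - σ v)) - σ v - S (R (F x - σ v))‖ ≤ η * ‖R (F x - σ v)‖) :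
    p (F x - σ (v + R (F x - σ v))) ≤
      (q + η * (Cp * (1 + ‖S‖ * ‖R‖ + ‖R‖ * (‖T‖ + 1)) / cp)) * p (x - σ v) := by
  set y := x - σ v with hy
  set d := F x - σ v with hd
  set e₁ := d - T y with he₁
  have hye : ‖y‖ ≤ p y / cp := by rw [le_div_iff₀ hcp]; linarith [hlow y]
  have h1 : ‖e₁‖ ≤ η * ‖y‖ := by simpa [hfix] using hF
  have h2 : ‖d‖ ≤ (‖T‖ + 1) * ‖y‖ := by
    have : d = T y + e₁ := by rw [he₁]; abel
    rw [this]
    calc ‖T y + e₁‖ ≤ ‖T y‖ + ‖e₁‖ := norm_add_le _ _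
      _ ≤ ‖T‖ * ‖y‖ + η * ‖y‖ := add_le_add (T.le_opNorm y) h1
      _ ≤ (‖T‖ + 1) * ‖y‖ := by nlinarith [norm_nonneg y]
  have h3 : ‖R d‖ ≤ ‖R‖ * (‖T‖ + 1) * ‖y‖ := by
    calc ‖R d‖ ≤ ‖R‖ * ‖d‖ := R.le_opNorm d
      _ ≤ ‖R‖ * ((‖T‖ + 1) * ‖y‖) := by gcongr
      _ = _ := by ring
  set e₂ := σ (v + R d) - σ v - S (R d) with he₂
  -- The new remainder is the contracted linear part plus the linearization errors `e₁` of `F` and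
  -- `e₂` of `σ`, both of order `η ‖y‖`.
  have hdec : F x - σ (v + R d) = (T y - S (R (T y))) + (e₁ - S (R e₁) - e₂) := by
    simp only [he₁, he₂, map_sub, hd]; abel
  have h4 : ‖e₁ - S (R e₁) - e₂‖ ≤ η * (1 + ‖S‖ * ‖R‖ + ‖R‖ * (‖T‖ + 1)) * ‖y‖ := by
    have h5 : ‖S (R e₁)‖ ≤ ‖S‖ * ‖R‖ * (η * ‖y‖) :=
      calc ‖S (R e₁)‖ ≤ ‖S‖ * ‖R e₁‖ := S.le_opNorm _
        _ ≤ ‖S‖ * (‖R‖ * ‖e₁‖) := by gcongr; exact R.le_opNorm _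
        _ ≤ ‖S‖ * (‖R‖ * (η * ‖y‖)) := by gcongr
        _ = _ := by ring
    have h6 : ‖e₂‖ ≤ η * (‖R‖ * (‖T‖ + 1) * ‖y‖) := hσ.trans (by gcongr)
    have := norm_sub_le (e₁ - S (R e₁)) e₂
    have := norm_sub_le e₁ (S (R e₁))
    linarith
  calc p (F x - σ (v + R d)) ≤ p (T y - S (R (T y))) + p (e₁ - S (R e₁) - e₂) := by
        rw [hdec]; exact map_add_le_add p _ _
    _ ≤ q * p y + Cp * (η * (1 + ‖S‖ * ‖R‖ + ‖R‖ * (‖T‖ + 1)) * ‖y‖) :=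
        add_le_add (hcontr y) ((hup _).trans (by gcongr))
    _ ≤ q * p y + Cp * (η * (1 + ‖S‖ * ‖R‖ + ‖R‖ * (‖T‖ + 1)) * (p y / cp)) := by gcongr
    _ = _ := by ring

/-- Local convergence of an iteration towards a manifold of fixed points `σ`, when the derivative
contracts modulo the tangent space of the manifold. -/
theorem iterate_tendsto_fixed_manifold {X V : Type*} [NormedAddCommGroup X] [NormedSpace ℝ X]
    [NormedAddCommGroup V] [NormedSpace ℝ V] [CompleteSpace V] {F : X → X} {σ : V → X} {v₀ : V}
    {T : X →L[ℝ] X} {S : V →L[ℝ] X} (R : X →L[ℝ] V) (hF : HasStrictFDerivAt F T (σ v₀))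
    (hσ : HasStrictFDerivAt σ S v₀) (hfix : ∀ᶠ v in 𝓝 v₀, F (σ v) = σ v)
    (p : Seminorm ℝ X) {cp Cp : ℝ} (hcp : 0 < cp) (hCp : 0 ≤ Cp)
    (hlow : ∀ x, cp * ‖x‖ ≤ p x) (hup : ∀ x, p x ≤ Cp * ‖x‖) {q : ℝ} (hq0 : 0 ≤ q) (hq1 : q < 1)
    (hcontr : ∀ x, p (T x - S (R (T x))) ≤ q * p x) {ε : ℝ} (hε : 0 < ε) :
    ∃ δ > 0, ∀ x₀, ‖x₀ - σ v₀‖ < δ → (∀ n, ‖F^[n] x₀ - σ v₀‖ < ε) ∧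
      ∃ v, ‖v - v₀‖ < ε ∧ Tendsto (fun n => F^[n] x₀) atTop (𝓝 (σ v)) := by
  -- `D` bounds the shift of the base point by the remainder; `B` is the coefficient of `η` in
  -- `tracking_step`.
  set D := ‖R‖ * (‖T‖ + 1) / cp with hDdef
  have hD0 : 0 ≤ D := by positivity
  set B := Cp * (1 + ‖S‖ * ‖R‖ + ‖R‖ * (‖T‖ + 1)) / cp with hBdef
  have hB0 : 0 ≤ B := by positivity
  obtain ⟨η, hη0, hη1, hηB⟩ : ∃ η : ℝ, 0 < η ∧ η ≤ 1 ∧ q + η * B ≤ (1 + q) / 2 := by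
    refine ⟨min 1 ((1 - q) / 2 / (B + 1)), ?_, min_le_left _ _, ?_⟩
    · have : 0 < 1 - q := by linarith
      positivity
    · have h1 : min 1 ((1 - q) / 2 / (B + 1)) * B ≤ (1 - q) / 2 / (B + 1) * (B + 1) := by
        have : 0 < 1 - q := by linarith
        gcongr
        · exact min_le_right _ _
        · linarith
      rw [div_mul_cancel₀ _ (by positivity)] at h1
      linarith
  set θ := (1 + q) / 2 with hθ
  have hθ0 : 0 ≤ θ := by rw [hθ]; linarith
  have hθ1 : θ < 1 := by rw [hθ]; linarith
  obtain ⟨r₁, hr₁, hF'⟩ := hF.exists_ball_norm_le hη0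
  obtain ⟨r₂, hr₂, hσ'⟩ := hσ.exists_ball_norm_le hη0
  obtain ⟨r₃, hr₃, hfix'⟩ := Metric.eventually_nhds_iff.1 hfix
  have hσc := Metric.continuousAt_iff.1 hσ.continuousAt (min r₁ ε / 2) (by positivity)
  obtain ⟨r₄, hr₄, hσc⟩ := hσc
  set r := min (min r₂ r₃) (min r₄ ε) with hr
  have hr0 : 0 < r := by positivity
  -- the size of the initial remainder, measured by `p`
  obtain ⟨m, hm0, hm1, hm2⟩ : ∃ m : ℝ, 0 < m ∧ D * m / (1 - θ) < r ∧ m / cp < min r₁ ε / 2 := by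
    have h1θ : 0 < 1 - θ := by linarith
    refine ⟨min (r * (1 - θ) / (D + 1)) (cp * (min r₁ ε / 4)), by positivity, ?_, ?_⟩
    · rw [div_lt_iff₀ h1θ]
      calc D * min (r * (1 - θ) / (D + 1)) (cp * (min r₁ ε / 4))
          ≤ D * (r * (1 - θ) / (D + 1)) := by gcongr; exact min_le_left _ _
        _ < (D + 1) * (r * (1 - θ) / (D + 1)) := by
            apply mul_lt_mul_of_pos_right (by linarith); positivity
        _ = r * (1 - θ) := by field_simp
    · rw [div_lt_iff₀ hcp]
      have : 0 < min r₁ ε := by positivity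
      calc _ ≤ cp * (min r₁ ε / 4) := min_le_right _ _
        _ < _ := by nlinarith
  refine ⟨m / (Cp + 1), by positivity, fun x₀ hx₀ => ?_⟩
  -- The base point absorbs, through `R`, the tangential part of each displacement, so that only the
  -- contracted part stays in the remainder.
  set W : ℕ → V := fun n => Nat.rec v₀ (fun n v => v + R (F (F^[n] x₀) - σ v)) n with hW
  have hW0 : W 0 = v₀ := rfl
  have hWs : ∀ n, W (n + 1) = W n + R (F (F^[n] x₀) - σ (W n)) := fun n => rfl
  set x : ℕ → X := fun n => F^[n] x₀ with hx
  have hxs : ∀ n, x (n + 1) = F (x n) := fun n => Function.iterate_succ_apply' F n x₀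
  have hp0 : p (x 0 - σ (W 0)) ≤ m := by
    calc p (x 0 - σ (W 0)) ≤ Cp * ‖x₀ - σ v₀‖ := hup _
      _ ≤ (Cp + 1) * (m / (Cp + 1)) := by gcongr; linarith
      _ = m := by field_simp
  have hgeom : ∀ n, (∑ i ∈ Finset.range n, θ ^ i) ≤ 1 / (1 - θ) := fun n => by
    have h1θ : 0 < 1 - θ := by linarith
    rw [geom_sum_eq hθ1.ne, le_div_iff₀ h1θ, ← neg_div_neg_eq, neg_sub, neg_sub,
      div_mul_cancel₀ _ h1θ.ne']
    linarith [pow_nonneg hθ0 n]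
  have hball : ∀ n, ‖W n - v₀‖ ≤ D * m * ∑ i ∈ Finset.range n, θ ^ i → ‖W n - v₀‖ < r := by
    intro n h
    refine lt_of_le_of_lt (h.trans ?_) hm1
    calc D * m * ∑ i ∈ Finset.range n, θ ^ i ≤ D * m * (1 / (1 - θ)) := by gcongr; exact hgeom n
      _ = _ := by ring
  have hclose : ∀ v, ‖v - v₀‖ < r → ‖σ v - σ v₀‖ < min r₁ ε / 2 := by
    intro v hv
    have := @hσc v (by
      rw [dist_eq_norm]
      exact hv.trans_le ((min_le_right _ _).trans (min_le_left _ _)))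
    rwa [dist_eq_norm] at this
  have hxclose : ∀ n, ‖W n - v₀‖ < r → p (x n - σ (W n)) ≤ θ ^ n * m →
      ‖x n - σ v₀‖ < min r₁ ε := by
    intro n h1 h2
    have h3 : ‖x n - σ (W n)‖ < min r₁ ε / 2 := by
      refine lt_of_le_of_lt ?_ hm2
      rw [le_div_iff₀ hcp, mul_comm]
      refine (hlow _).trans (h2.trans ?_)
      nlinarith [pow_le_one₀ (n := n) hθ0 hθ1.le]
    have h4 := hclose _ h1
    calc ‖x n - σ v₀‖ = ‖(x n - σ (W n)) + (σ (W n) - σ v₀)‖ := by congr 1; abel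
      _ ≤ _ := norm_add_le _ _
      _ < _ := by linarith
  have hmain : ∀ n, p (x n - σ (W n)) ≤ θ ^ n * m ∧
      ‖W n - v₀‖ ≤ D * m * ∑ i ∈ Finset.range n, θ ^ i ∧ ‖W (n + 1) - W n‖ ≤ D * m * θ ^ n := by
    have hstep : ∀ n, p (x n - σ (W n)) ≤ θ ^ n * m →
        ‖W n - v₀‖ ≤ D * m * ∑ i ∈ Finset.range n, θ ^ i →
        ‖W (n + 1) - W n‖ ≤ D * m * θ ^ n ∧ p (x (n + 1) - σ (W (n + 1))) ≤ θ ^ (n + 1) * m ∧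
        ‖W (n + 1) - v₀‖ ≤ D * m * ∑ i ∈ Finset.range (n + 1), θ ^ i := by
      intro n h1 h2
      have hWr := hball n h2
      have hxr := hxclose n hWr h1
      have hσr := (hclose _ hWr).trans_le (half_le_self (by positivity))
      have hfixn : F (σ (W n)) = σ (W n) := hfix' (by
        rw [dist_eq_norm]; exact hWr.trans_le ((min_le_left _ _).trans (min_le_right _ _)))
      have hFn := hF' (x n) (σ (W n)) (hxr.trans_le (min_le_left _ _))
        (hσr.trans_le (min_le_left _ _))
      have hinc : ‖R (F (x n) - σ (W n))‖ ≤ D * p (x n - σ (W n)) := by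
        have h3 : ‖F (x n) - σ (W n)‖ ≤ (‖T‖ + 1) * ‖x n - σ (W n)‖ := by
          have h4 : F (x n) - σ (W n) = T (x n - σ (W n)) +
              (F (x n) - F (σ (W n)) - T (x n - σ (W n))) := by rw [hfixn]; abel
          rw [h4]
          calc _ ≤ _ := norm_add_le _ _
            _ ≤ ‖T‖ * ‖x n - σ (W n)‖ + 1 * ‖x n - σ (W n)‖ :=
              add_le_add (T.le_opNorm _) (hFn.trans (by gcongr))
            _ = _ := by ring
        calc _ ≤ ‖R‖ * ‖F (x n) - σ (W n)‖ := R.le_opNorm _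
          _ ≤ ‖R‖ * ((‖T‖ + 1) * (p (x n - σ (W n)) / cp)) := by
            gcongr
            refine h3.trans ?_
            gcongr
            rw [le_div_iff₀ hcp, mul_comm]; exact hlow _
          _ = _ := by rw [hDdef]; ring
      have hinc' : ‖W (n + 1) - W n‖ ≤ D * m * θ ^ n := by
        rw [hWs, add_sub_cancel_left]
        calc _ ≤ D * p (x n - σ (W n)) := hinc
          _ ≤ D * (θ ^ n * m) := by gcongr
          _ = _ := by ring
      have hWn1 : ‖W (n + 1) - v₀‖ ≤ D * m * ∑ i ∈ Finset.range (n + 1), θ ^ i := by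
        rw [Finset.sum_range_succ, mul_add]
        calc ‖W (n + 1) - v₀‖ = ‖(W n - v₀) + (W (n + 1) - W n)‖ := by congr 1; abel
          _ ≤ _ := norm_add_le _ _
          _ ≤ _ := add_le_add h2 hinc'
      refine ⟨hinc', ?_, hWn1⟩
      have hWr' := hball (n + 1) hWn1
      have hσn := hσ' (W (n + 1)) (W n)
        (hWr'.trans_le ((min_le_left _ _).trans (min_le_left _ _)))
        (hWr.trans_le ((min_le_left _ _).trans (min_le_left _ _)))
      rw [hWs, add_sub_cancel_left] at hσn
      have := tracking_step R p hcp hCp hlow hup hcontr hη0.le hη1 hfixn hFn hσn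
      rw [hxs, hWs]
      refine this.trans ?_
      calc _ ≤ θ * (θ ^ n * m) := by
            apply mul_le_mul hηB h1 (apply_nonneg _ _) hθ0
        _ = _ := by ring
    have hind : ∀ n, p (x n - σ (W n)) ≤ θ ^ n * m ∧
        ‖W n - v₀‖ ≤ D * m * ∑ i ∈ Finset.range n, θ ^ i := by
      intro n
      induction n with
      | zero => exact ⟨by simpa using hp0, by simp [hW0]⟩
      | succ n ih => exact (hstep n ih.1 ih.2).2
    exact fun n => ⟨(hind n).1, (hind n).2, (hstep n (hind n).1 (hind n).2).1⟩
  have hWr : ∀ n, ‖W n - v₀‖ < r := fun n => hball n (hmain n).2.1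
  refine ⟨fun n => (hxclose n (hWr n) (hmain n).1).trans_le (min_le_right _ _), ?_⟩
  have hcau : CauchySeq W := cauchySeq_of_le_geometric θ (D * m) hθ1 fun n => by
    rw [dist_comm, dist_eq_norm]; exact (hmain n).2.2
  obtain ⟨v, hv⟩ := cauchySeq_tendsto_of_complete hcau
  have hvr : ‖v - v₀‖ < r := by
    refine lt_of_le_of_lt (le_of_tendsto ((hv.sub_const v₀).norm)
      (Eventually.of_forall fun n => ?_)) hm1
    calc _ ≤ _ := (hmain n).2.1
      _ ≤ D * m * (1 / (1 - θ)) := by gcongr; exact hgeom n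
      _ = _ := by ring
  refine ⟨v, hvr.trans_le ((min_le_right _ _).trans (min_le_right _ _)), ?_⟩
  rw [tendsto_iff_norm_sub_tendsto_zero]
  -- Strict differentiability makes `σ` Lipschitz near `v₀` with constant `‖S‖ + η`, which carries
  -- convergence of the base points over to the iterates.
  have hbound : ∀ n, ‖x n - σ v‖ ≤ θ ^ n * m / cp + (‖S‖ + η) * ‖W n - v‖ := by
    intro n
    have h1 : ‖x n - σ (W n)‖ ≤ θ ^ n * m / cp := by
      rw [le_div_iff₀ hcp, mul_comm]; exact (hlow _).trans (hmain n).1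
    have h2 : ‖σ (W n) - σ v‖ ≤ (‖S‖ + η) * ‖W n - v‖ := by
      have h3 := hσ' (W n) v ((hWr n).trans_le ((min_le_left _ _).trans (min_le_left _ _)))
        (hvr.trans_le ((min_le_left _ _).trans (min_le_left _ _)))
      calc ‖σ (W n) - σ v‖ = ‖S (W n - v) + (σ (W n) - σ v - S (W n - v))‖ := by congr 1; abel
        _ ≤ _ := norm_add_le _ _
        _ ≤ ‖S‖ * ‖W n - v‖ + η * ‖W n - v‖ := add_le_add (S.le_opNorm _) h3
        _ = _ := by ring
    calc ‖x n - σ v‖ = ‖(x n - σ (W n)) + (σ (W n) - σ v)‖ := by congr 1; abel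
      _ ≤ _ := norm_add_le _ _
      _ ≤ _ := add_le_add h1 h2
  refine squeeze_zero (fun n => norm_nonneg _) hbound ?_
  have h1 : Tendsto (fun n : ℕ => θ ^ n * m / cp) atTop (𝓝 (0 * m / cp)) :=
    ((tendsto_pow_atTop_nhds_zero_of_lt_one hθ0 hθ1).mul_const m).div_const cp
  have h2 : Tendsto (fun n => (‖S‖ + η) * ‖W n - v‖) atTop (𝓝 ((‖S‖ + η) * 0)) :=
    (tendsto_iff_norm_sub_tendsto_zero.1 hv).const_mul _
  simpa using h1.add h2

/-- Instability of a fixed point from geometric growth of the derivative: the map is assumed to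
have a quadratic remainder, and the growth rate of its derivative to be attained. -/
theorem exists_iterate_far {X : Type*} [NormedAddCommGroup X] [NormedSpace ℝ X] {F : X → X}
    {x₀ : X} {T : X →L[ℝ] X} {C r ρ κ : ℝ} (hr : 0 < r) (hC : 0 ≤ C)
    (hρ : 1 < ρ) (hκ : 0 < κ) (p : Seminorm ℝ X) {cp Cp : ℝ} (hcp : 0 < cp) (hCp : 0 < Cp)
    (hlow : ∀ x, cp * ‖x‖ ≤ p x) (hup : ∀ x, p x ≤ Cp * ‖x‖)
    (hquad : ∀ x, ‖x - x₀‖ < r → ‖F x - x₀ - T (x - x₀)‖ ≤ C * ‖x - x₀‖ ^ 2)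
    (hT : ∀ x, p (T x) ≤ ρ * p x)
    (hgrow : ∀ n : ℕ, ∃ h, p h ≤ 1 ∧ κ * ρ ^ n ≤ p ((T ^ n) h)) :
    ∃ ε > 0, ε ≤ r ∧ ∀ δ > 0, ∃ x, ‖x - x₀‖ < δ ∧
      ∃ n, (∀ m < n, ‖F^[m] x - x₀‖ < ε) ∧ ε ≤ ‖F^[n] x - x₀‖ := by
  set C' := Cp * C / cp ^ 2 with hC'
  have hC'0 : 0 ≤ C' := by positivity
  have hquad' : ∀ x, ‖x - x₀‖ < r → p (F x - x₀ - T (x - x₀)) ≤ C' * p (x - x₀) ^ 2 := by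
    intro x hx
    have h1 : ‖x - x₀‖ ≤ p (x - x₀) / cp := by rw [le_div_iff₀ hcp, mul_comm]; exact hlow _
    calc _ ≤ Cp * ‖F x - x₀ - T (x - x₀)‖ := hup _
      _ ≤ Cp * (C * (p (x - x₀) / cp) ^ 2) := by
        gcongr; exact (hquad x hx).trans (by gcongr)
      _ = _ := by rw [hC']; ring
  -- `a` closes the induction `error_j ≤ a (s ρ^j)²`: one step needs `4 C' + ρ a ≤ a ρ²`. The
  -- summand 1 keeps `a` positive when `C' = 0`.
  set a := 4 * C' / (ρ ^ 2 - ρ) + 1 with ha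
  have hρρ : 0 < ρ ^ 2 - ρ := by nlinarith
  have ha0 : 0 < a := by positivity
  have ha' : 4 * C' ≤ a * (ρ ^ 2 - ρ) := by
    rw [ha, add_mul, div_mul_cancel₀ _ hρρ.ne']; linarith
  -- As long as `s ρ^j ≤ τ`, the error is at most `s ρ^j` and at most half of the guaranteed linear
  -- size `κ s ρ^j`.
  set τ := min 1 (κ / 2) / a with hτ
  have hτ0 : 0 < τ := by positivity
  have haτ : a * τ = min 1 (κ / 2) := by rw [hτ]; field_simp
  have haτ1 : a * τ ≤ 1 := haτ.le.trans (min_le_left _ _)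
  have haτ2 : a * τ ≤ κ / 2 := haτ.le.trans (min_le_right _ _)
  set ε := min r (τ * κ / (2 * ρ) / Cp) with hε
  have hε0 : 0 < ε := by have : 0 < ρ := by linarith
                         positivity
  refine ⟨ε, hε0, min_le_left _ _, fun δ hδ => ?_⟩
  set s := min (cp * δ / 2) τ with hs
  have hs0 : 0 < s := by positivity
  -- `n` is the last time with `s ρ^n ≤ τ`; then `s ρ^n > τ / ρ`, a size independent of `δ`.
  obtain ⟨n, hn1, hn2⟩ := exists_nat_pow_near (x := τ / s) (y := ρ)
    ((one_le_div hs0).2 (min_le_right _ _)) hρ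
  rw [le_div_iff₀ hs0] at hn1
  rw [div_lt_iff₀ hs0] at hn2
  obtain ⟨h, hh1, hh2⟩ := hgrow n
  refine ⟨x₀ + s • h, ?_, ?_⟩
  · rw [add_sub_cancel_left]
    have h1 : cp * ‖s • h‖ ≤ cp * δ / 2 := by
      refine (hlow _).trans ?_
      rw [map_smul_eq_mul, Real.norm_of_nonneg hs0.le]
      calc s * p h ≤ s * 1 := by gcongr
        _ ≤ _ := by rw [mul_one]; exact min_le_left _ _
    have h2 : ‖s • h‖ ≤ δ / 2 := by
      rw [mul_div_assoc] at h1; exact le_of_mul_le_mul_left h1 hcp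
    linarith
  · set x : ℕ → X := fun n => F^[n] (x₀ + s • h) with hx
    have hxs : ∀ n, x (n + 1) = F (x n) := fun n => Function.iterate_succ_apply' F n _
    have hex : ∃ n, ε ≤ ‖x n - x₀‖ := by
      by_contra! hcon
      have hxr : ∀ j, ‖x j - x₀‖ < r := fun j => (hcon j).trans_le (min_le_left _ _)
      have hpT : ∀ j, p ((T ^ j) h) ≤ ρ ^ j := by
        intro j
        induction j with
        | zero => simpa using hh1
        | succ j ih =>
          rw [pow_succ' T, mul_apply_eq_comp]
          calc _ ≤ ρ * p ((T ^ j) h) := hT _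
            _ ≤ ρ * ρ ^ j := by gcongr
            _ = _ := by ring
      have hind : ∀ j, j ≤ n → p (x j - x₀ - s • (T ^ j) h) ≤ a * (s * ρ ^ j) ^ 2 := by
        intro j
        induction j with
        | zero =>
          intro _
          simp only [hx, Function.iterate_zero, id, pow_zero, one_apply_eq_self,
            add_sub_cancel_left, sub_self, map_zero]
          positivity
        | succ j ih =>
          intro hj
          have ih := ih (by omega)
          have hsj : s * ρ ^ j ≤ τ := by
            have : ρ ^ j ≤ ρ ^ n := pow_le_pow_right₀ hρ.le (by omega)
            nlinarith
          have hsj0 : 0 < s * ρ ^ j := by positivity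
          have hpx : p (x j - x₀) ≤ 2 * (s * ρ ^ j) := by
            calc p (x j - x₀) = p ((x j - x₀ - s • (T ^ j) h) + s • (T ^ j) h) := by
                  congr 1; abel
              _ ≤ _ := map_add_le_add p _ _
              _ ≤ a * (s * ρ ^ j) ^ 2 + s * ρ ^ j := by
                refine add_le_add ih ?_
                rw [map_smul_eq_mul, Real.norm_of_nonneg hs0.le]
                gcongr; exact hpT j
              _ ≤ 2 * (s * ρ ^ j) := by
                have : a * (s * ρ ^ j) ≤ 1 := (mul_le_mul_of_nonneg_left hsj ha0.le).trans haτ1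
                nlinarith
          have hdec : x (j + 1) - x₀ - s • (T ^ (j + 1)) h =
              (F (x j) - x₀ - T (x j - x₀)) + T (x j - x₀ - s • (T ^ j) h) := by
            rw [hxs, pow_succ' T, mul_apply_eq_comp, map_sub T _ (s • _), map_smul]
            abel
          rw [hdec]
          calc _ ≤ p (F (x j) - x₀ - T (x j - x₀)) + p (T (x j - x₀ - s • (T ^ j) h)) :=
                map_add_le_add p _ _
            _ ≤ C' * (2 * (s * ρ ^ j)) ^ 2 + ρ * (a * (s * ρ ^ j) ^ 2) := by
              refine add_le_add ((hquad' _ (hxr j)).trans ?_) ((hT _).trans ?_)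
              · gcongr
              · gcongr
            _ = (4 * C' + ρ * a) * (s * ρ ^ j) ^ 2 := by ring
            _ ≤ (a * ρ ^ 2) * (s * ρ ^ j) ^ 2 := by gcongr; linarith
            _ = _ := by ring
      have h1 := hind n le_rfl
      have hsn : s * ρ ^ n ≤ τ := by linarith
      have hsn0 : 0 < s * ρ ^ n := by positivity
      have h2 : s * (κ * ρ ^ n) ≤ p (x n - x₀) + a * (s * ρ ^ n) ^ 2 := by
        calc s * (κ * ρ ^ n) ≤ s * p ((T ^ n) h) := by gcongr
          _ = p (s • (T ^ n) h) := by rw [map_smul_eq_mul, Real.norm_of_nonneg hs0.le]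
          _ = p ((x n - x₀) - (x n - x₀ - s • (T ^ n) h)) := by congr 1; abel
          _ ≤ p (x n - x₀) + p (x n - x₀ - s • (T ^ n) h) := map_sub_le_add p _ _
          _ ≤ _ := by gcongr
      have h3 : κ / 2 * (s * ρ ^ n) ≤ p (x n - x₀) := by
        have : a * (s * ρ ^ n) ≤ κ / 2 := (mul_le_mul_of_nonneg_left hsn ha0.le).trans haτ2
        nlinarith
      have h4 : τ * κ / (2 * ρ) < p (x n - x₀) := by
        refine lt_of_lt_of_le ?_ h3
        rw [div_lt_iff₀ (by positivity)]
        rw [pow_succ] at hn2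
        nlinarith
      have h5 := (hcon n).trans_le (min_le_right _ _)
      rw [lt_div_iff₀ hCp] at h5
      linarith [hup (x n - x₀)]
    -- The first exit time is taken, so that all earlier iterates lie in the ball of radius `ε`.
    classical
    exact ⟨Nat.find hex, fun m hm => not_le.1 (Nat.find_min hex hm), Nat.find_spec hex⟩

/-! ### Quadratic remainders and an adapted norm -/

/-- A map that is twice continuously differentiable at a point has a quadratic Taylor remainder. -/
theorem ContDiffAt.exists_quadratic_remainder {X Y : Type*} [NormedAddCommGroup X]
    [NormedSpace ℝ X] [NormedAddCommGroup Y] [NormedSpace ℝ Y] {f : X → Y} {x₀ : X}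
    (hf : ContDiffAt ℝ 2 f x₀) :
    (fun x => f x - f x₀ - fderiv ℝ f x₀ (x - x₀)) =O[𝓝 x₀] fun x => ‖x - x₀‖ ^ 2 := by
  have h1 : ContDiffAt ℝ 1 (fderiv ℝ f) x₀ := hf.fderiv_right (by norm_num)
  have h2 := (h1.differentiableAt (by norm_num)).hasFDerivAt.isBigO_sub
  obtain ⟨C, hC0, hC⟩ := h2.exists_pos
  have h3 : ∀ᶠ x in 𝓝 x₀, DifferentiableAt ℝ f x :=
    (hf.eventually (by norm_num)).mono fun x hx => hx.differentiableAt (by norm_num)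
  obtain ⟨r, hr, h4⟩ := Metric.eventually_nhds_iff_ball.1 (hC.bound.and h3)
  refine Asymptotics.IsBigO.of_bound C ?_
  filter_upwards [Metric.ball_mem_nhds x₀ hr] with x hx
  have hsub : Metric.closedBall x₀ ‖x - x₀‖ ⊆ Metric.ball x₀ r :=
    Metric.closedBall_subset_ball (by rwa [← dist_eq_norm])
  -- On the closed ball of radius `‖x - x₀‖` the derivative differs from its value at `x₀` by at
  -- most `C ‖x - x₀‖`; the mean value inequality supplies the second factor.
  have := (convex_closedBall x₀ ‖x - x₀‖).norm_image_sub_le_of_norm_hasFDerivWithin_le'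
    (f := f) (f' := fderiv ℝ f) (φ := fderiv ℝ f x₀) (C := C * ‖x - x₀‖) (x := x₀) (y := x)
    (fun y hy => (h4 y (hsub hy)).2.hasFDerivAt.hasFDerivWithinAt)
    (fun y hy => (h4 y (hsub hy)).1.trans (by
      rw [Metric.mem_closedBall, dist_eq_norm] at hy; gcongr))
    (Metric.mem_closedBall_self (norm_nonneg _)) (by simp [dist_eq_norm])
  calc _ ≤ _ := this
    _ = _ := by simp; ring

/-- An operator that maps into the range of a projection and is bounded by `ρ` there has bound `ρ`
in an equivalent norm. -/
theorem exists_seminorm_map_le {H : Type*} [NormedAddCommGroup H] [NormedSpace ℝ H] {T Q : H →L[ℝ] H} (hTQ : ∀ x, Q (T x) = T x)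
    (hQ : ∀ x, Q (Q x) = Q x) (hQ1 : ∀ x, ‖Q x‖ ≤ ‖x‖) {ρ : ℝ} (hρ : 0 < ρ)
    (hT : ∀ x, Q x = x → ‖T x‖ ≤ ρ * ‖x‖) :
    ∃ p : Seminorm ℝ H, ∃ C > 0, (∀ x, ‖x‖ ≤ p x) ∧ (∀ x, p x ≤ C * ‖x‖) ∧
      (∀ x, Q x = x → p x = ‖x‖) ∧ ∀ x, p (T x) ≤ ρ * p x := by
  set L : NNReal := ⟨‖T‖ / ρ, by positivity⟩ with hL
  -- The weight `‖T‖ / ρ` pays for the part of `x` outside the range of `Q`: `‖T‖ ‖x - Q x‖` is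
  -- exactly `ρ` times the added term, which vanishes at `T x`.
  let p : Seminorm ℝ H := normSeminorm ℝ H +
    L • (normSeminorm ℝ H).comp ((1 - Q : H →L[ℝ] H) : H →ₗ[ℝ] H)
  have hp : ∀ x, p x = ‖x‖ + ‖T‖ / ρ * ‖x - Q x‖ := fun x => rfl
  have hpQ : ∀ x, Q x = x → p x = ‖x‖ := fun x hx => by rw [hp, hx]; simp
  refine ⟨p, 1 + ‖T‖ / ρ * 2, by positivity, fun x => ?_, fun x => ?_, hpQ, fun x => ?_⟩
  · rw [hp]; have : 0 ≤ ‖T‖ / ρ * ‖x - Q x‖ := by positivity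
    linarith
  · rw [hp]
    have : ‖x - Q x‖ ≤ 2 * ‖x‖ := (norm_sub_le _ _).trans (by linarith [hQ1 x])
    calc _ ≤ ‖x‖ + ‖T‖ / ρ * (2 * ‖x‖) := by gcongr
      _ = _ := by ring
  · rw [hpQ _ (hTQ x), hp]
    calc ‖T x‖ = ‖T (Q x) + T (x - Q x)‖ := by rw [← map_add]; congr 2; abel
      _ ≤ ‖T (Q x)‖ + ‖T (x - Q x)‖ := norm_add_le _ _
      _ ≤ ρ * ‖Q x‖ + ‖T‖ * ‖x - Q x‖ := add_le_add (hT _ (hQ x)) (T.le_opNorm _)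
      _ ≤ ρ * ‖x‖ + ‖T‖ * ‖x - Q x‖ := by gcongr; exact hQ1 x
      _ = _ := by field_simp

/-! ### Spectrum and coercivity of compressions in a Hilbert space -/

section Hilbert

open scoped InnerProductSpace InnerProduct

variable {H : Type*} [NormedAddCommGroup H] [InnerProductSpace ℝ H] [CompleteSpace H]

/-- Expanding the square, the cross term is `-2 t ‖B x‖²` and the last term is at most `t² ‖B‖² ‖B
x‖²`. The sign of `2 - t ‖B‖²` separates the stable from the unstable regime. -/
theorem norm_sub_smul_adjoint_comp_sq_le (B : H →L[ℝ] H) (t : ℝ) (x : H) :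
    ‖x - t • (B†) (B x)‖ ^ 2 ≤ ‖x‖ ^ 2 - t * (2 - t * ‖B‖ ^ 2) * ‖B x‖ ^ 2 := by
  have h1 : ‖(B†) (B x)‖ ≤ ‖B‖ * ‖B x‖ := by
    simpa using (B†).le_opNorm (B x)
  have h2 : ‖(B†) (B x)‖ ^ 2 ≤ ‖B‖ ^ 2 * ‖B x‖ ^ 2 := by
    rw [← mul_pow]; gcongr
  have h3 : ⟪x, t • (B†) (B x)⟫_ℝ = t * ‖B x‖ ^ 2 := by
    rw [inner_smul_right, ContinuousLinearMap.adjoint_inner_right, real_inner_self_eq_norm_sq]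
  rw [norm_sub_sq_real, h3, norm_smul, mul_pow, Real.norm_eq_abs, sq_abs]
  nlinarith [sq_nonneg t]

theorem norm_adjoint_comp_sub_smul_sq_le (B : H →L[ℝ] H) (x : H) :
    ‖(B†) (B x) - ‖B‖ ^ 2 • x‖ ^ 2 ≤ ‖B‖ ^ 2 * (‖B‖ ^ 2 * ‖x‖ ^ 2 - ‖B x‖ ^ 2) := by
  have h1 : ‖(B†) (B x)‖ ≤ ‖B‖ * ‖B x‖ := by
    simpa using (B†).le_opNorm (B x)
  have h2 : ‖(B†) (B x)‖ ^ 2 ≤ ‖B‖ ^ 2 * ‖B x‖ ^ 2 := by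
    rw [← mul_pow]; gcongr
  have h3 : ⟪(B†) (B x), ‖B‖ ^ 2 • x⟫_ℝ = ‖B‖ ^ 2 * ‖B x‖ ^ 2 := by
    rw [inner_smul_right, ContinuousLinearMap.adjoint_inner_left, real_inner_self_eq_norm_sq]
  rw [norm_sub_sq_real, h3, norm_smul, mul_pow, Real.norm_eq_abs, sq_abs]
  nlinarith

/-- Vectors that almost attain `‖B‖` are approximate eigenvectors of `B† B` for `‖B‖²`, with no
compactness involved. Applying `Q` to such a vector loses nothing, because `B Q = B` and `Q` does
not increase norms. -/
theorem exists_unit_adjoint_comp_sub_smul_le {B Q : H →L[ℝ] H} (hB : B ≠ 0)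
    (hQ : ∀ x, Q (Q x) = Q x) (hQ1 : ∀ x, ‖Q x‖ ≤ ‖x‖) (hBQ : ∀ x, B (Q x) = B x) {η : ℝ}
    (hη : 0 < η) : ∃ x, Q x = x ∧ ‖x‖ = 1 ∧ ‖(B†) (B x) - ‖B‖ ^ 2 • x‖ ≤ η := by
  have hB0 : 0 < ‖B‖ := norm_pos_iff.2 hB
  -- Chosen so that `‖B‖² (‖B‖² - b²) ≤ 2 ‖B‖³ (‖B‖ - b) ≤ η²`; the entry `‖B‖ / 2` only keeps `b`
  -- positive.
  set b := max (‖B‖ / 2) (‖B‖ - η ^ 2 / (2 * ‖B‖ ^ 3)) with hb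
  have hb0 : 0 < b := lt_of_lt_of_le (by positivity) (le_max_left _ _)
  have hb1 : b < ‖B‖ := by
    rw [hb, max_lt_iff]
    constructor
    · linarith
    · have : 0 < η ^ 2 / (2 * ‖B‖ ^ 3) := by positivity
      linarith
  obtain ⟨y, hy⟩ : ∃ y, b * ‖y‖ < ‖B y‖ := by
    by_contra! h
    exact absurd (B.opNorm_le_bound hb0.le h) (not_le.2 hb1)
  have hy' : b * ‖Q y‖ < ‖B (Q y)‖ := by
    rw [hBQ]; exact lt_of_le_of_lt (by gcongr; exact hQ1 y) hy
  have hne : 0 < ‖Q y‖ := by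
    rw [norm_pos_iff]; rintro h; simp [h] at hy'
  refine ⟨‖Q y‖⁻¹ • Q y, by rw [map_smul, hQ], norm_smul_inv_norm (norm_pos_iff.1 hne), ?_⟩
  set x := ‖Q y‖⁻¹ • Q y with hx
  have hx1 : ‖x‖ = 1 := norm_smul_inv_norm (norm_pos_iff.1 hne)
  have hBx : b ≤ ‖B x‖ := by
    rw [hx, map_smul, norm_smul, norm_inv, norm_norm, inv_mul_eq_div, le_div_iff₀ hne]
    exact hy'.le
  refine abs_le_of_sq_le_sq' ?_ hη.le |>.2
  refine (norm_adjoint_comp_sub_smul_sq_le B x).trans ?_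
  rw [hx1, one_pow, mul_one]
  have h1 : ‖B‖ ^ 2 - ‖B x‖ ^ 2 ≤ 2 * ‖B‖ * (‖B‖ - b) := by nlinarith
  have h2 : ‖B‖ - b ≤ η ^ 2 / (2 * ‖B‖ ^ 3) := by
    have := le_max_right (‖B‖ / 2) (‖B‖ - η ^ 2 / (2 * ‖B‖ ^ 3)); linarith
  calc _ ≤ ‖B‖ ^ 2 * (2 * ‖B‖ * (η ^ 2 / (2 * ‖B‖ ^ 3))) := by
        gcongr; exact h1.trans (by gcongr)
    _ = η ^ 2 := by field_simp

theorem norm_apply_le_of_adjoint_eq_self {Q : H →L[ℝ] H} (hQ : Q * Q = Q) (hQs : Q† = Q) (x : H) :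
    ‖Q x‖ ≤ ‖x‖ := by
  have hQx : Q (Q x) = Q x := congrArg (fun f : H →L[ℝ] H => f x) hQ
  have h1 : ‖Q x‖ ^ 2 ≤ ‖Q x‖ * ‖x‖ := by
    calc ‖Q x‖ ^ 2 = ⟪Q x, Q x⟫_ℝ := (real_inner_self_eq_norm_sq _).symm
      _ = ⟪Q x, x⟫_ℝ := by
        nth_rw 2 [← hQs]; rw [ContinuousLinearMap.adjoint_inner_right, hQx]
      _ ≤ _ := real_inner_le_norm _ _
  by_contra! h
  nlinarith [norm_nonneg x, norm_nonneg (Q x)]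

/-- The least point of the spectrum of `-Q A† Q A`, for an orthogonal projection `Q`. -/
theorem isLeast_spectrum_neg_compression [Nontrivial H] {A Q : H →L[ℝ] H} (hQ : Q * Q = Q)
    (hQs : Q† = Q) :
    IsLeast (spectrum ℝ (-(Q * A† * Q * A))) (-‖Q * A * Q‖ ^ 2) := by
  set B := Q * A * Q with hB
  have hBs : B† = Q * A† * Q := by
    rw [hB, ← ContinuousLinearMap.star_eq_adjoint, star_mul, star_mul,
      ContinuousLinearMap.star_eq_adjoint, ContinuousLinearMap.star_eq_adjoint, hQs, mul_assoc]
  have hD : -(Q * A† * Q * A) = -(B† * A) := by rw [hBs]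
  have hQx : ∀ x, Q (Q x) = Q x := fun x => congrArg (fun f : H →L[ℝ] H => f x) hQ
  have hQ1 := norm_apply_le_of_adjoint_eq_self hQ hQs
  constructor
  · by_cases hB0 : B = 0
    · have : -(Q * A† * Q * A) = 0 := by rw [hD, hB0]; simp
      rw [this, hB0, norm_zero]; simp
    · intro hunit
      obtain ⟨v, hv⟩ := hunit
      set D := -(Q * A† * Q * A) with hDdef
      -- A bounded inverse would bound unit vectors by their images, against the approximate
      -- eigenvectors of `B† B`.
      have hinv : ∀ x, ‖x‖ ≤ ‖(↑v⁻¹ : H →L[ℝ] H)‖ * ‖(↑v : H →L[ℝ] H) x‖ := fun x => by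
        have h1 : (↑v⁻¹ : H →L[ℝ] H) ((↑v : H →L[ℝ] H) x) = x := by
          rw [← ContinuousLinearMap.comp_apply, ← ContinuousLinearMap.mul_def, Units.inv_mul]; rfl
        calc ‖x‖ = ‖(↑v⁻¹ : H →L[ℝ] H) ((↑v : H →L[ℝ] H) x)‖ := by rw [h1]
          _ ≤ _ := ContinuousLinearMap.le_opNorm _ _
      set c := ‖(↑v⁻¹ : H →L[ℝ] H)‖
      obtain ⟨x, hx1, hx2, hx3⟩ := exists_unit_adjoint_comp_sub_smul_le hB0 hQx hQ1
        (fun x => by simp [hB, hQx]) (η := 1 / (2 * (c + 1))) (by positivity)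
      have h1 : (↑v : H →L[ℝ] H) x = (B†) (B x) - ‖B‖ ^ 2 • x := by
        rw [hv, hDdef, hBs]
        simp [hB, hx1, hQx, Algebra.algebraMap_eq_smul_one]
        abel
      have h2 := hinv x
      rw [h1, hx2] at h2
      have h3 : c * ‖(B†) (B x) - ‖B‖ ^ 2 • x‖ ≤ (c + 1) * (1 / (2 * (c + 1))) := by
        gcongr; linarith
      have h4 : (c + 1) * (1 / (2 * (c + 1))) = 1 / 2 := by
        have : c + 1 ≠ 0 := by positivity
        field_simp
      linarith
  · intro t ht
    by_cases ht0 : t = 0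
    · rw [ht0]; nlinarith [sq_nonneg ‖B‖]
    -- The operator need not be self-adjoint. Moving a factor `Q` from the left to the right keeps
    -- the nonzero spectrum and produces `-B† B`, whose norm is at most `‖B‖²`.
    have h1 : -(Q * A† * Q * A) = Q * (-(Q * A† * Q * A)) := by
      simp only [mul_neg, ← mul_assoc, hQ]
    rw [h1] at ht
    have h2 : t ∈ spectrum ℝ (-(Q * A† * Q * A) * Q) \ {0} := by
      rw [← spectrum.nonzero_mul_comm]; exact ⟨ht, ht0⟩
    have h3 : -(Q * A† * Q * A) * Q = -(B† * B) := by
      rw [hBs, hB]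
      simp only [neg_mul, mul_assoc]
      congr 3
      simp only [← mul_assoc, hQ]
    rw [h3] at h2
    have h4 := spectrum.norm_le_norm_of_mem h2.1
    have h5 : ‖-(B† * B)‖ ≤ ‖B‖ ^ 2 := by
      rw [norm_neg, sq]
      exact (norm_mul_le _ _).trans (by simp)
    have h6 := abs_le.1 ((Real.norm_eq_abs t ▸ h4).trans h5)
    linarith [h6.1]

/-- Coercivity of a compression `Q A` of an operator with closed range, where the complement of the
range of `Q` is spanned by images `A m_k`. -/
theorem exists_lower_bound_of_isClosed_range {κ : Type*} [Fintype κ] [DecidableEq κ]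
    {A Q : H →L[ℝ] H}
    (hA : IsClosed (Set.range A)) {m f : κ → H} (hm : ∀ k, A (m k) = f k)
    (hQf : ∀ x, ∃ a : κ → ℝ, x - Q x = ∑ k, a k • f k)
    (hfQ : ∀ k x, Q x = x → ⟪f k, x⟫_ℝ = 0) (hker : ∀ x, A x = 0 → Q x = x)
    (hdet : (Matrix.of fun i j => ⟪f i, m j⟫_ℝ).det ≠ 0) :
    ∃ c > 0, ∀ w, Q w = w → (∀ g, A g = 0 → ⟪g, w⟫_ℝ = 0) → c * ‖w‖ ≤ ‖Q (A w)‖ := by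
  have hAc : IsClosed (LinearMap.range (A : H →ₗ[ℝ] H) : Set H) := by
    rwa [LinearMap.coe_range]
  have : CompleteSpace (LinearMap.range (A : H →ₗ[ℝ] H)) := hAc.completeSpace_coe
  -- The open mapping theorem: closed range gives preimages with norm control.
  obtain ⟨c, hc0, hc⟩ := A.rangeRestrict.exists_preimage_norm_le (by
    rintro ⟨y, x, rfl⟩; exact ⟨x, rfl⟩)
  set D : Matrix κ κ ℝ := Matrix.of fun i j => ⟪f i, m j⟫_ℝ with hD
  set b : ℝ := 1 + ∑ k, (∑ i, |D⁻¹ k i| * ‖f i‖) * ‖m k‖ with hb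
  have hb0 : 0 < b := by positivity
  refine ⟨1 / (b * c), by positivity, fun w hw1 hw2 => ?_⟩
  obtain ⟨a, ha⟩ := hQf (A w)
  -- Since `f k = A (m k)`, this correction of `w` puts `Q (A w)` itself into the range of `A`.
  set z := w - ∑ k, a k • m k with hz
  have hAz : A z = Q (A w) := by
    rw [hz, map_sub, map_sum]
    simp only [map_smul, hm]
    rw [← ha]; abel
  obtain ⟨r, hr1, hr2⟩ := hc ⟨Q (A w), z, hAz⟩
  have hAr : A r = Q (A w) := congrArg Subtype.val hr1
  have hr2 : ‖r‖ ≤ c * ‖Q (A w)‖ := hr2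
  have hg : A (z - r) = 0 := by rw [map_sub, hAz, hAr, sub_self]
  have hwdec : w = (z - r) + (r + ∑ k, a k • m k) := by rw [hz]; abel
  -- Both `w` and the kernel part `z - r` are orthogonal to `f i`, which leaves a linear system for
  -- `a` with invertible matrix `D`; so `a` is bounded by `‖r‖`.
  have hlin : ∀ i, (D.mulVec a) i = -⟪f i, r⟫_ℝ := by
    intro i
    have h1 := hfQ i w hw1
    rw [hwdec, inner_add_right, hfQ i _ (hker _ hg), inner_add_right, inner_sum] at h1
    simp only [inner_smul_right] at h1
    have h2 : D.mulVec a i = ∑ k, a k * ⟪f i, m k⟫_ℝ := by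
      simp [Matrix.mulVec, dotProduct, hD, mul_comm]
    rw [h2]; linarith
  have hak : ∀ k, |a k| ≤ (∑ i, |D⁻¹ k i| * ‖f i‖) * ‖r‖ := by
    intro k
    have h1 : a = D⁻¹.mulVec (D.mulVec a) := by
      rw [Matrix.mulVec_mulVec, Matrix.nonsing_inv_mul _ (isUnit_iff_ne_zero.2 hdet),
        Matrix.one_mulVec]
    have h2 : a k = ∑ i, D⁻¹ k i * -⟪f i, r⟫_ℝ := by
      conv_lhs => rw [h1]
      simp only [Matrix.mulVec, dotProduct] at hlin ⊢
      exact Finset.sum_congr rfl fun i _ => by rw [hlin i]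
    rw [h2, Finset.sum_mul]
    refine (Finset.abs_sum_le_sum_abs _ _).trans (Finset.sum_le_sum fun i _ => ?_)
    rw [abs_mul, abs_neg, mul_assoc]
    gcongr
    exact abs_real_inner_le_norm _ _
  have hnorm : ‖r + ∑ k, a k • m k‖ ≤ b * ‖r‖ := by
    calc _ ≤ ‖r‖ + ∑ k, ‖a k • m k‖ := (norm_add_le _ _).trans (by gcongr; exact norm_sum_le _ _)
      _ ≤ ‖r‖ + ∑ k, ((∑ i, |D⁻¹ k i| * ‖f i‖) * ‖r‖) * ‖m k‖ := by
        gcongr with k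
        rw [norm_smul, Real.norm_eq_abs]
        gcongr
        exact hak k
      _ = b * ‖r‖ := by
        rw [hb, add_mul, one_mul, Finset.sum_mul]
        congr 1
        exact Finset.sum_congr rfl fun k _ => by ring
  have hw : ‖w‖ ≤ b * ‖r‖ := by
    have h1 : ‖w‖ ^ 2 ≤ ‖w‖ * (b * ‖r‖) := by
      calc ‖w‖ ^ 2 = ⟪(z - r) + (r + ∑ k, a k • m k), w⟫_ℝ := by
            rw [← hwdec, real_inner_self_eq_norm_sq]
        _ = ⟪r + ∑ k, a k • m k, w⟫_ℝ := by rw [inner_add_left, hw2 _ hg, zero_add]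
        _ ≤ ‖r + ∑ k, a k • m k‖ * ‖w‖ := real_inner_le_norm _ _
        _ ≤ _ := by rw [mul_comm]; gcongr
    by_contra! h
    have : 0 ≤ b * ‖r‖ := by positivity
    nlinarith
  rw [div_mul_eq_mul_div, one_mul, div_le_iff₀ (by positivity)]
  calc ‖w‖ ≤ b * (c * ‖Q (A w)‖) := hw.trans (by gcongr)
    _ = _ := by ring

end Hilbert

/-! ### Hilbert structure from a coercive form -/

section Renorming

universe w

/-- `H` is `X` with the norm of the form and the equivalence is the identity; the existential keeps
the two normed structures apart. -/
theorem InnerProductSpace.Core.exists_continuousLinearEquiv {X : Type w} [AddCommGroup X]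
    [Module ℝ X] [TopologicalSpace X] [IsTopologicalAddGroup X] [ContinuousConstSMul ℝ X]
    (cd : InnerProductSpace.Core ℝ X) (h : ContinuousAt (fun v : X => cd.inner v v) 0)
    (h' : Bornology.IsVonNBounded ℝ {v : X | cd.inner v v < 1}) :
    ∃ (H : Type w) (_ : NormedAddCommGroup H) (_ : InnerProductSpace ℝ H) (e : X ≃L[ℝ] H),
      ∀ a b, inner ℝ (e a) (e b) = cd.inner a b := by
  let _ : NormedAddCommGroup X := cd.toNormedAddCommGroupOfTopology h h'
  let _ : InnerProductSpace ℝ X := .ofCoreOfTopology cd h h'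
  exact ⟨X, inferInstance, inferInstance, ContinuousLinearEquiv.refl ℝ X, fun a b => rfl⟩

/-- A Banach space with a coercive bounded symmetric bilinear form is isomorphic to a Hilbert space
whose inner product is that form. -/
theorem exists_hilbert_of_coercive_form {X : Type w} [NormedAddCommGroup X] [NormedSpace ℝ X]
    [CompleteSpace X] (b : X →L[ℝ] X →L[ℝ] ℝ) (hsymm : ∀ x y, b x y = b y x) {c : ℝ} (hc : 0 < c)
    (hb : ∀ x, c * ‖x‖ ^ 2 ≤ b x x) :
    ∃ (H : Type w) (_ : NormedAddCommGroup H) (_ : InnerProductSpace ℝ H) (_ : CompleteSpace H)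
      (e : X ≃L[ℝ] H), ∀ x y, inner ℝ (e x) (e y) = b x y := by
  let cd : InnerProductSpace.Core ℝ X :=
    { inner := fun x y => b x y
      conj_inner_symm := fun x y => by simpa using hsymm y x
      re_inner_nonneg := fun x => le_trans (by positivity) (hb x)
      add_left := fun x y z => by simp
      smul_left := fun x y r => by simp
      definite := fun x hx => by
        have h1 := hb x
        have h2 : b x x = 0 := hx
        rw [h2] at h1
        have h3 : ‖x‖ ^ 2 ≤ 0 := by nlinarith [sq_nonneg ‖x‖]
        simpa using h3 }
  obtain ⟨H, i1, i2, e, he⟩ := cd.exists_continuousLinearEquiv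
    (show ContinuousAt (fun v : X => b v v) 0 by fun_prop)
    (by
      rw [NormedSpace.isVonNBounded_iff, isBounded_iff_forall_norm_le]
      refine ⟨√(1 / c), fun x hx => ?_⟩
      have h1 : b x x < 1 := hx
      refine Real.le_sqrt_of_sq_le ?_
      rw [le_div_iff₀ hc]
      linarith [hb x])
  exact ⟨H, i1, i2, (completeSpace_congr (e := e.toEquiv) e.isUniformEmbedding).1 inferInstance, e, he⟩

end Renorming

/-! ### Richardson iteration below and above the threshold -/

section Iteration

open scoped InnerProductSpace InnerProduct

variable {H : Type*} [NormedAddCommGroup H] [InnerProductSpace ℝ H] [CompleteSpace H]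

/-- Richardson iteration `1 - t B† B` on the range of `Q`, with `t ‖B‖² < 2`, contracts modulo the
kernel of `A`, where `B = Q A Q`. -/
theorem exists_seminorm_contraction {A Q T : H →L[ℝ] H} (hQ : Q * Q = Q) (hQs : Q† = Q)
    (hTQ : ∀ x, Q (T x) = T x) {t : ℝ} (ht : 0 < t)
    (hT : ∀ x, Q x = x → T x = x - t • ((Q * A * Q)†) ((Q * A * Q) x))
    (hker : ∀ x, A x = 0 → Q x = x) {P : H →L[ℝ] H} (hPA : ∀ x, A (P x) = 0)
    (hP : ∀ x g, A g = 0 → ⟪g, x - P x⟫_ℝ = 0) {c : ℝ} (hc : 0 < c)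
    (hlow : ∀ w, Q w = w → (∀ g, A g = 0 → ⟪g, w⟫_ℝ = 0) → c * ‖w‖ ≤ ‖Q (A w)‖)
    (hsmall : t * ‖Q * A * Q‖ ^ 2 < 2) :
    ∃ p : Seminorm ℝ H, ∃ C > 0, ∃ q, 0 ≤ q ∧ q < 1 ∧ (∀ x, ‖x‖ ≤ p x) ∧ (∀ x, p x ≤ C * ‖x‖) ∧
      ∀ x, p (T x - P (T x)) ≤ q * p x := by
  set B := Q * A * Q with hB
  have hQx : ∀ x, Q (Q x) = Q x := fun x => congrArg (fun f : H →L[ℝ] H => f x) hQ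
  have hQ1 := norm_apply_le_of_adjoint_eq_self hQ hQs
  have hPQ : ∀ x, Q (P x) = P x := fun x => hker _ (hPA x)
  have hBP : ∀ x, B (P x) = 0 := fun x => by simp [hB, hPQ, hPA]
  have hPuniq : ∀ x y, A y = 0 → (∀ g, A g = 0 → ⟪g, x - y⟫_ℝ = 0) → P x = y := by
    intro x y hy hxy
    have h1 : A (P x - y) = 0 := by rw [map_sub, hPA, hy, sub_zero]
    have h2 : ⟪P x - y, P x - y⟫_ℝ = 0 := by
      have h3 := hP x _ h1
      have h4 := hxy _ h1
      have h5 : P x - y = (x - y) - (x - P x) := by abel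
      nth_rw 2 [h5]
      rw [inner_sub_right, h3, h4, sub_zero]
    exact sub_eq_zero.1 (inner_self_eq_zero.1 h2)
  -- The relative decrease of `‖w‖²` in one step, from the expansion of the square and `‖B w‖ ≥ c
  -- ‖w‖`.
  set κ := t * (2 - t * ‖B‖ ^ 2) * c ^ 2 with hκ
  have hκ0 : 0 < κ := by
    have : 0 < 2 - t * ‖B‖ ^ 2 := by linarith
    positivity
  -- The `1 / 4` keeps the rate positive, as the adapted norm of `exists_seminorm_map_le` requires.
  set q := √(max (1 - κ) (1 / 4)) with hq
  have hq0 : 0 < q := Real.sqrt_pos.2 (lt_of_lt_of_le (by norm_num) (le_max_right _ _))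
  have hq1 : q < 1 := by
    rw [hq, Real.sqrt_lt' one_pos, one_pow, max_lt_iff]; constructor <;> linarith
  have hq2 : 1 - κ ≤ q ^ 2 := by
    rw [hq, Real.sq_sqrt (le_trans (by norm_num) (le_max_right _ _))]; exact le_max_left _ _
  have hcontr : ∀ x, Q x = x → ‖(T - P * T) x‖ ≤ q * ‖x‖ := by
    intro x hx
    set w := x - P x with hw
    have hwQ : Q w = w := by rw [hw, map_sub, hx, hPQ]
    have hworth : ∀ g, A g = 0 → ⟪g, w⟫_ℝ = 0 := hP x
    have hBw : B x = B w := by rw [hw, map_sub, hBP, sub_zero]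
    -- The increment lies in the range of `B†`, and `B` vanishes on the kernel of `A`; so the kernel
    -- component does not move.
    have hPT : P (T x) = P x := by
      refine hPuniq _ _ (hPA x) fun g hg => ?_
      have h1 : T x - P x = w - t • (B†) (B x) := by rw [hT x hx, hw]; abel
      have h2 : B g = 0 := by simp [hB, hker g hg, hg]
      rw [h1, inner_sub_right, hworth g hg, inner_smul_right,
        ContinuousLinearMap.adjoint_inner_right, h2, inner_zero_left]; simp
    have h1 : (T - P * T) x = w - t • (B†) (B w) := by
      have : (T - P * T) x = T x - P (T x) := rfl
      rw [this, hPT, hT x hx, ← hBw, hw]; abel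
    have h2 : c * ‖w‖ ≤ ‖B w‖ := by
      have : B w = Q (A w) := by simp [hB, hwQ]
      rw [this]; exact hlow w hwQ hworth
    have h3 : c ^ 2 * ‖w‖ ^ 2 ≤ ‖B w‖ ^ 2 := by rw [← mul_pow]; gcongr
    have h4 : ‖w‖ ≤ ‖x‖ := by
      have h5 : ⟪P x, w⟫_ℝ = 0 := hworth _ (hPA x)
      have h6 : ‖x‖ ^ 2 = ‖P x‖ ^ 2 + ‖w‖ ^ 2 := by
        have : x = P x + w := by rw [hw]; abel
        nth_rw 1 [this]
        rw [norm_add_sq_real, h5]; ring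
      exact abs_le_of_sq_le_sq' (by nlinarith [sq_nonneg ‖P x‖]) (norm_nonneg x) |>.2
    rw [h1]
    have h5 : ‖w - t • (B†) (B w)‖ ^ 2 ≤ (q * ‖w‖) ^ 2 := by
      refine (norm_sub_smul_adjoint_comp_sq_le B t w).trans ?_
      have h6 : 0 < t * (2 - t * ‖B‖ ^ 2) := by
        have : 0 < 2 - t * ‖B‖ ^ 2 := by linarith
        positivity
      have h7 := mul_le_mul_of_nonneg_left h3 h6.le
      have h8 := mul_le_mul_of_nonneg_right hq2 (sq_nonneg ‖w‖)
      rw [mul_pow]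
      have h9 : κ * ‖w‖ ^ 2 = t * (2 - t * ‖B‖ ^ 2) * (c ^ 2 * ‖w‖ ^ 2) := by rw [hκ]; ring
      linarith
    have h6 := (abs_le_of_sq_le_sq' h5 (by positivity)).2
    exact h6.trans (by gcongr)
  obtain ⟨p, C, hC, h1, h2, -, h3⟩ := exists_seminorm_map_le (T := T - P * T) (Q := Q)
    (fun x => by simp [hTQ, hPQ]) hQx hQ1 hq0 hcontr
  exact ⟨p, C, hC, q, hq0.le, hq1, h1, h2, h3⟩

/-- Richardson iteration `1 - t B† B` on the range of `Q`, with `t ‖B‖² > 2`, has the growth rate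
`t ‖B‖² - 1`, which is attained up to a constant. -/
theorem exists_seminorm_growth {A Q T : H →L[ℝ] H} (hQ : Q * Q = Q) (hQs : Q† = Q)
    (hTQ : ∀ x, Q (T x) = T x) {t : ℝ} (ht : 0 < t)
    (hT : ∀ x, Q x = x → T x = x - t • ((Q * A * Q)†) ((Q * A * Q) x))
    (hlarge : 2 < t * ‖Q * A * Q‖ ^ 2) :
    ∃ p : Seminorm ℝ H, ∃ C > 0, ∃ ρ > 1, (∀ x, ‖x‖ ≤ p x) ∧ (∀ x, p x ≤ C * ‖x‖) ∧
      (∀ x, p (T x) ≤ ρ * p x) ∧ ∀ n : ℕ, ∃ h, p h ≤ 1 ∧ 1 / 2 * ρ ^ n ≤ p ((T ^ n) h) := by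
  set B := Q * A * Q with hB
  have hB0 : B ≠ 0 := by rintro h; rw [h] at hlarge; simp at hlarge; linarith
  have hQx : ∀ x, Q (Q x) = Q x := fun x => congrArg (fun f : H →L[ℝ] H => f x) hQ
  have hQ1 := norm_apply_le_of_adjoint_eq_self hQ hQs
  -- `-ρ = 1 - t ‖B‖²` is the value of `1 - t B† B` on approximate eigenvectors for `‖B‖²`.
  set ρ := t * ‖B‖ ^ 2 - 1 with hρ
  have hρ1 : 1 < ρ := by linarith
  have hTρ : ∀ x, Q x = x → ‖T x‖ ≤ ρ * ‖x‖ := by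
    intro x hx
    have h1 : ‖B x‖ ^ 2 ≤ ‖B‖ ^ 2 * ‖x‖ ^ 2 := by
      rw [← mul_pow]; have := B.le_opNorm x; gcongr
    have h2 := norm_sub_smul_adjoint_comp_sq_le B t x
    have h3 : 0 ≤ t * (t * ‖B‖ ^ 2 - 2) := mul_nonneg ht.le (by linarith)
    have h4 := mul_le_mul_of_nonneg_left h1 h3
    rw [← hT x hx] at h2
    have h5 : ‖T x‖ ^ 2 ≤ (ρ * ‖x‖) ^ 2 := by
      have : (ρ * ‖x‖) ^ 2 = ‖x‖ ^ 2 + t * (t * ‖B‖ ^ 2 - 2) * (‖B‖ ^ 2 * ‖x‖ ^ 2) := by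
        rw [hρ]; ring
      rw [this]; linarith
    exact (abs_le_of_sq_le_sq' h5 (by positivity)).2
  obtain ⟨p, C, hC, h1, h2, h3, h4⟩ := exists_seminorm_map_le hTQ hQx hQ1 (by linarith) hTρ
  refine ⟨p, C, hC, ρ, hρ1, h1, h2, h4, fun n => ?_⟩
  -- The accuracy depends on `n`: over `n` steps the errors add up to at most `n ρ^n / (2 (n + 1))`,
  -- less than half of `ρ^n`.
  obtain ⟨x, hx1, hx2, hx3⟩ := exists_unit_adjoint_comp_sub_smul_le hB0 hQx hQ1
    (fun x => by simp [hB, hQx]) (η := 1 / (2 * t * (n + 1))) (by positivity)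
  have hTx : ‖T x + ρ • x‖ ≤ 1 / (2 * (n + 1)) := by
    have h5 : T x + ρ • x = -(t • ((B†) (B x) - ‖B‖ ^ 2 • x)) := by
      rw [hT x hx1, hρ]; module
    rw [h5, norm_neg, norm_smul, Real.norm_of_nonneg ht.le]
    calc _ ≤ t * (1 / (2 * t * (n + 1))) := by gcongr
      _ = _ := by field_simp
  have hind : ∀ j : ℕ, Q ((T ^ j) x) = (T ^ j) x ∧
      ‖(T ^ j) x - (-ρ) ^ j • x‖ ≤ j * ρ ^ j * (1 / (2 * (n + 1))) := by
    intro j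
    induction j with
    | zero => simp [hx1]
    | succ j ih =>
      rw [pow_succ' T, mul_apply_eq_comp]
      refine ⟨hTQ _, ?_⟩
      have h5 : T ((T ^ j) x) - (-ρ) ^ (j + 1) • x =
          T ((T ^ j) x - (-ρ) ^ j • x) + (-ρ) ^ j • (T x + ρ • x) := by
        rw [map_sub, map_smul]; module
      have h6 : Q ((T ^ j) x - (-ρ) ^ j • x) = (T ^ j) x - (-ρ) ^ j • x := by
        rw [map_sub, ih.1, map_smul, hx1]
      have h7 : ‖(-ρ) ^ j • (T x + ρ • x)‖ ≤ ρ ^ (j + 1) * (1 / (2 * (n + 1))) := by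
        rw [norm_smul, norm_pow, norm_neg, Real.norm_of_nonneg (by linarith)]
        gcongr
        · exact hρ1.le
        · omega
      calc _ ≤ _ := by rw [h5]; exact norm_add_le _ _
        _ ≤ ρ * (j * ρ ^ j * (1 / (2 * (n + 1)))) + ρ ^ (j + 1) * (1 / (2 * (n + 1))) :=
          add_le_add ((hTρ _ h6).trans (by gcongr; exact ih.2)) h7
        _ = _ := by push_cast; ring
  refine ⟨x, (h3 x hx1).trans_le hx2.le, ?_⟩
  obtain ⟨h5, h6⟩ := hind n
  rw [h3 _ h5]
  have h7 : ‖(-ρ) ^ n • x‖ = ρ ^ n := by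
    rw [norm_smul, hx2, norm_pow, norm_neg, Real.norm_of_nonneg (by linarith), mul_one]
  have h8 := norm_sub_norm_le ((-ρ) ^ n • x) ((T ^ n) x)
  rw [norm_sub_rev, h7] at h8
  have h9 : n * ρ ^ n * (1 / (2 * (n + 1))) ≤ 1 / 2 * ρ ^ n := by
    have : (n : ℝ) * (1 / (2 * (n + 1))) ≤ 1 / 2 := by
      rw [mul_one_div, div_le_div_iff₀ (by positivity) (by norm_num)]; linarith
    calc _ = (n * (1 / (2 * (n + 1)))) * ρ ^ n := by ring
      _ ≤ _ := by gcongr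
  linarith

end Iteration

/-! ### The energy form and the constraint projection -/

namespace PCSOM

/-- Cauchy–Schwarz for the form gives `‖M a‖² ≤ ‖M‖ · M a a`, and boundedness of the inverse gives
`‖a‖ ≤ ‖M⁻¹‖ ‖M a‖`. Positivity alone would not yield a uniform constant. -/
theorem exists_coercive_of_pos {V : Type*} [NormedAddCommGroup V] [NormedSpace ℝ V]
    (M : V ≃L[ℝ] StrongDual ℝ V) (hsymm : ∀ a b, M a b = M b a) (hpos : ∀ a, a ≠ 0 → 0 < M a a) :
    ∃ c > 0, ∀ a, c * ‖a‖ ^ 2 ≤ M a a := by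
  have hnn : ∀ a, 0 ≤ M a a := fun a => by
    by_cases h : a = 0
    · simp [h]
    · exact (hpos a h).le
  have hcs : ∀ a b, M a b ^ 2 ≤ M a a * M b b := by
    intro a b
    have h1 : ∀ t : ℝ, 0 ≤ M b b * (t * t) + (2 * M a b) * t + M a a := fun t => by
      have h2 := hnn (a + t • b)
      simp only [map_add, map_smul, add_apply,
        smul_apply, smul_eq_mul, hsymm b a] at h2
      linarith
    have h3 := discrim_le_zero h1
    rw [discrim] at h3
    linarith
  set m := ‖(M : V →L[ℝ] StrongDual ℝ V)‖
  have hm0 : 0 ≤ m := by positivity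
  set m' := ‖(M.symm : StrongDual ℝ V →L[ℝ] V)‖
  refine ⟨1 / (m' ^ 2 * m + 1), by positivity, fun a => ?_⟩
  have h1 : ‖M a‖ ≤ √(M a a * m) := by
    refine ContinuousLinearMap.opNorm_le_bound _ (Real.sqrt_nonneg _) fun b => ?_
    have h2 : M b b ≤ m * ‖b‖ ^ 2 := by
      calc M b b ≤ ‖M b b‖ := le_abs_self _
        _ ≤ m * ‖b‖ * ‖b‖ := (M : V →L[ℝ] StrongDual ℝ V).le_opNorm₂ b b
        _ = _ := by ring
    have h3 : ‖M a b‖ ^ 2 ≤ (√(M a a * m) * ‖b‖) ^ 2 := by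
      rw [Real.norm_eq_abs, sq_abs, mul_pow, Real.sq_sqrt (mul_nonneg (hnn a) hm0)]
      calc _ ≤ M a a * M b b := hcs a b
        _ ≤ M a a * (m * ‖b‖ ^ 2) := mul_le_mul_of_nonneg_left h2 (hnn a)
        _ = _ := by ring
    exact (abs_le_of_sq_le_sq' h3 (by positivity)).2
  have h2 : ‖a‖ ≤ m' * ‖M a‖ := by
    simpa using (M.symm : StrongDual ℝ V →L[ℝ] V).le_opNorm (M a)
  have h3 : ‖a‖ ^ 2 ≤ m' ^ 2 * (M a a * m) := by
    calc ‖a‖ ^ 2 ≤ (m' * √(M a a * m)) ^ 2 := by gcongr; exact h2.trans (by gcongr)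
      _ = _ := by rw [mul_pow, Real.sq_sqrt (mul_nonneg (hnn a) hm0)]
  rw [div_mul_eq_mul_div, one_mul, div_le_iff₀ (by positivity)]
  nlinarith [hnn a]

noncomputable section

variable {N K : ℕ} {E : Fin K → Type*} [∀ k, NormedAddCommGroup (E k)] [∀ k, NormedSpace ℝ (E k)]

/-- The energy form `∑_k (M_k a_k) (b_k)`. -/
def energyForm (M : ∀ k, E k ≃L[ℝ] StrongDual ℝ (E k)) : State E →L[ℝ] State E →L[ℝ] ℝ :=
  ∑ k, ((M k : E k →L[ℝ] StrongDual ℝ (E k)).bilinearComp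
    (ContinuousLinearMap.proj k : State E →L[ℝ] E k)
    (ContinuousLinearMap.proj k : State E →L[ℝ] E k))

theorem energyForm_apply (M : ∀ k, E k ≃L[ℝ] StrongDual ℝ (E k)) (a b : State E) :
    energyForm M a b = ∑ k, M k (a k) (b k) := by
  simp [energyForm]

theorem exists_coercive_energyForm (M : ∀ k, E k ≃L[ℝ] StrongDual ℝ (E k))
    (hMsymm : ∀ k a b, M k a b = M k b a) (hMpos : ∀ k a, a ≠ 0 → 0 < M k a a) :
    ∃ c > 0, ∀ a, c * ‖a‖ ^ 2 ≤ energyForm M a a := by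
  choose c hc0 hc using fun k => exists_coercive_of_pos (M k) (hMsymm k) (hMpos k)
  have hnn : ∀ k a, 0 ≤ M k a a := fun k a => le_trans (by have := hc0 k; positivity) (hc k a)
  have hS : 0 ≤ ∑ k, 1 / c k := Finset.sum_nonneg fun k _ => by have := hc0 k; positivity
  have hform : ∀ a, 0 ≤ energyForm M a a := fun a => by
    rw [energyForm_apply]; exact Finset.sum_nonneg fun k _ => hnn k _
  refine ⟨1 / (∑ k, 1 / c k + 1), by positivity, fun a => ?_⟩
  rw [div_mul_eq_mul_div, one_mul, div_le_iff₀ (by positivity)]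
  have h0 : 0 ≤ energyForm M a a * (∑ k, 1 / c k + 1) := mul_nonneg (hform a) (by positivity)
  have h1 : ‖a‖ ≤ √(energyForm M a a * (∑ k, 1 / c k + 1)) := by
    refine (pi_norm_le_iff_of_nonneg (Real.sqrt_nonneg _)).2 fun k => Real.le_sqrt_of_sq_le ?_
    have h2 : M k (a k) (a k) ≤ energyForm M a a := by
      rw [energyForm_apply]
      exact Finset.single_le_sum (f := fun k => M k (a k) (a k)) (fun k _ => hnn k _)
        (Finset.mem_univ k)
    have h3 : 1 / c k ≤ ∑ k, 1 / c k :=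
      Finset.single_le_sum (f := fun k => 1 / c k)
        (fun k _ => by have := hc0 k; positivity) (Finset.mem_univ k)
    have h4 : ‖a k‖ ^ 2 ≤ M k (a k) (a k) * (1 / c k) := by
      rw [mul_one_div, le_div_iff₀ (hc0 k), mul_comm]; exact hc k _
    calc _ ≤ _ := h4
      _ ≤ energyForm M a a * (∑ k, 1 / c k + 1) := by
        apply mul_le_mul h2 (by linarith) (by have := hc0 k; positivity) (hform a)
  calc ‖a‖ ^ 2 ≤ √(energyForm M a a * (∑ k, 1 / c k + 1)) ^ 2 := by gcongr
    _ = _ := Real.sq_sqrt h0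

theorem energyForm_Minv (M : ∀ k, E k ≃L[ℝ] StrongDual ℝ (E k)) (f : CoState E) (b : State E) :
    energyForm M (Minv M f) b = ∑ k, f k (b k) := by
  simp [energyForm_apply, Minv]

theorem sum_adj_apply (A : State E →L[ℝ] CoState E) (w v : State E) :
    ∑ k, adj A w k (v k) = ∑ j, A v j (w j) := by
  have h : ∀ j, ∑ k, A (Pi.single k (v k)) j (w j) = A v j (w j) := fun j => by
    conv_rhs => rw [← Finset.univ_sum_single v]
    simp [map_sum, Finset.sum_apply]
  simp only [adj, ContinuousLinearMap.coe_pi', sum_apply,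
    ContinuousLinearMap.comp_apply, ContinuousLinearMap.flip_apply,
    ContinuousLinearMap.proj_apply, ContinuousLinearMap.single_apply]
  rw [Finset.sum_comm]
  exact Finset.sum_congr rfl fun j _ => h j

/-- `M⁻¹ L₁†` is the adjoint of `M⁻¹ L₁` in the energy form. -/
theorem energyForm_Minv_adj (M : ∀ k, E k ≃L[ℝ] StrongDual ℝ (E k))
    (hMsymm : ∀ k a b, M k a b = M k b a) (A : State E →L[ℝ] CoState E) (w v : State E) :
    energyForm M (Minv M (adj A w)) v = energyForm M w (Minv M (A v)) := by
  have hs : energyForm M w (Minv M (A v)) = energyForm M (Minv M (A v)) w := by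
    simp only [energyForm_apply]
    exact Finset.sum_congr rfl fun k _ => hMsymm k _ _
  rw [hs, energyForm_Minv, energyForm_Minv, sum_adj_apply]

/-- The projection of `State E` onto `{x | ⟨u_k, x_k⟩ = 0 for all k}`, orthogonal in the energy
form. -/
def constraintProj (ι : ∀ k, E k →L[ℝ] L2 N) (M : ∀ k, E k ≃L[ℝ] StrongDual ℝ (E k))
    (u : State E) : State E →L[ℝ] State E :=
  1 - ContinuousLinearMap.pi fun k =>
    (((ip ι k (u k) ((M k).symm (toDual ι k (u k))))⁻¹ •
      (toDual ι k (u k)).comp (ContinuousLinearMap.proj k)).smulRight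
        ((M k).symm (toDual ι k (u k))))

theorem toDual_apply (ι : ∀ k, E k →L[ℝ] L2 N) (k : Fin K) (a b : E k) :
    toDual ι k a b = ip ι k a b := rfl

theorem constraintProj_apply (ι : ∀ k, E k →L[ℝ] L2 N) (M : ∀ k, E k ≃L[ℝ] StrongDual ℝ (E k))
    (u x : State E) (k : Fin K) :
    constraintProj ι M u x k = x k - ((ip ι k (u k) ((M k).symm (toDual ι k (u k))))⁻¹ *
      ip ι k (u k) (x k)) • (M k).symm (toDual ι k (u k)) := rfl

/-- This turns the corrections with `β_k`, `γ_k` and `μ_k` into one projection that is orthogonal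
for the energy form. -/
theorem Minv_sub_coeffDiag (ι : ∀ k, E k →L[ℝ] L2 N) (M : ∀ k, E k ≃L[ℝ] StrongDual ℝ (E k))
    (u : State E) (f : CoState E) :
    Minv M (f - coeffDiag ι M u f) = constraintProj ι M u (Minv M f) := by
  ext1 k
  rw [constraintProj_apply]
  simp [Minv, coeffDiag, coeff, toDual_apply]

theorem LPCV_eq (ι : ∀ k, E k →L[ℝ] L2 N) (M : ∀ k, E k ≃L[ℝ] StrongDual ℝ (E k))
    (L00 : State E → CoState E) (μ : Fin K → ℝ) (u : State E) :
    LPCV ι M L00 μ u = -(constraintProj ι M u * (Minv M).comp (adj (L1 ι L00 μ u)) *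
      constraintProj ι M u * (Minv M).comp (L1 ι L00 μ u)) := by
  ext1 x
  have h1 : LhatV ι M L00 μ u x =
      -adj (L1 ι L00 μ u) (Minv M (L1 ι L00 μ u x - coeffDiag ι M u (L1 ι L00 μ u x))) := rfl
  have h2 : LPCV ι M L00 μ u x =
      Minv M (LhatV ι M L00 μ u x - coeffDiag ι M u (LhatV ι M L00 μ u x)) := rfl
  rw [h2, Minv_sub_coeffDiag, h1, Minv_sub_coeffDiag, map_neg, map_neg]
  rfl

/-- The denominator equals `M_k b b` at `b = M_k⁻¹ a`. -/
theorem ip_Minv_toDual_pos (ι : ∀ k, E k →L[ℝ] L2 N) (hι : ∀ k, Function.Injective (ι k))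
    (M : ∀ k, E k ≃L[ℝ] StrongDual ℝ (E k)) (hMpos : ∀ k a, a ≠ 0 → 0 < M k a a)
    (k : Fin K) {a : E k} (ha : a ≠ 0) : 0 < ip ι k a ((M k).symm (toDual ι k a)) := by
  have h1 : (M k).symm (toDual ι k a) ≠ 0 := by
    intro h
    have h2 : toDual ι k a = 0 := by simpa using h
    have h3 : toDual ι k a a = 0 := by rw [h2]; rfl
    rw [toDual_apply, ip, inner_self_eq_zero, map_eq_zero_iff _ (hι k)] at h3
    exact ha h3
  have h2 := hMpos k _ h1
  rwa [ContinuousLinearEquiv.apply_symm_apply, toDual_apply] at h2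

section

variable {ι : ∀ k, E k →L[ℝ] L2 N} {M : ∀ k, E k ≃L[ℝ] StrongDual ℝ (E k)} {u : State E}

theorem ip_constraintProj (hu : ∀ k, ip ι k (u k) ((M k).symm (toDual ι k (u k))) ≠ 0)
    (x : State E) (k : Fin K) : ip ι k (u k) (constraintProj ι M u x k) = 0 := by
  rw [constraintProj_apply, ← toDual_apply, map_sub, map_smul, toDual_apply, toDual_apply,
    smul_eq_mul, mul_right_comm, inv_mul_cancel₀ (hu k), one_mul, sub_self]

theorem constraintProj_eq_self {x : State E} (hx : ∀ k, ip ι k (u k) (x k) = 0) :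
    constraintProj ι M u x = x := by
  ext1 k
  rw [constraintProj_apply, hx k, mul_zero, zero_smul, sub_zero]

theorem constraintProj_eq_self_iff
    (hu : ∀ k, ip ι k (u k) ((M k).symm (toDual ι k (u k))) ≠ 0) (x : State E) :
    constraintProj ι M u x = x ↔ ∀ k, ip ι k (u k) (x k) = 0 :=
  ⟨fun h k => h ▸ ip_constraintProj hu x k, constraintProj_eq_self⟩

theorem energyForm_constraintProj (hMsymm : ∀ k a b, M k a b = M k b a) (x y : State E) :
    energyForm M (constraintProj ι M u x) y = energyForm M x (constraintProj ι M u y) := by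
  simp only [energyForm_apply, constraintProj_apply]
  refine Finset.sum_congr rfl fun k _ => ?_
  have h1 : M k (x k) ((M k).symm (toDual ι k (u k))) = ip ι k (u k) (x k) := by
    rw [hMsymm, ContinuousLinearEquiv.apply_symm_apply, toDual_apply]
  simp only [map_sub, map_smul, sub_apply, smul_apply,
    ContinuousLinearEquiv.apply_symm_apply, h1, toDual_apply, smul_eq_mul]
  ring

end

/-- The component of `M⁻¹ diag(0, …, 1, …, 0) u` along which the `k`-th constraint is projected
out. -/
def constraintNormal (ι : ∀ k, E k →L[ℝ] L2 N) (M : ∀ k, E k ≃L[ℝ] StrongDual ℝ (E k))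
    (u : State E) (k : Fin K) : State E := Pi.single k ((M k).symm (toDual ι k (u k)))

/-- The normals are the Riesz representatives of the constraints in the energy form. -/
theorem energyForm_constraintNormal (ι : ∀ k, E k →L[ℝ] L2 N)
    (M : ∀ k, E k ≃L[ℝ] StrongDual ℝ (E k)) (u x : State E) (k : Fin K) :
    energyForm M (constraintNormal ι M u k) x = ip ι k (u k) (x k) := by
  rw [energyForm_apply, Finset.sum_eq_single k]
  · simp [constraintNormal, toDual_apply]
  · intro j _ hj
    simp [constraintNormal, Pi.single_eq_of_ne hj]
  · simp

theorem sub_constraintProj (ι : ∀ k, E k →L[ℝ] L2 N)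
    (M : ∀ k, E k ≃L[ℝ] StrongDual ℝ (E k)) (u x : State E) :
    x - constraintProj ι M u x = ∑ k, ((ip ι k (u k) ((M k).symm (toDual ι k (u k))))⁻¹ *
      ip ι k (u k) (x k)) • constraintNormal ι M u k := by
  ext1 k
  rw [Pi.sub_apply, constraintProj_apply, sub_sub_cancel, Finset.sum_apply,
    Finset.sum_eq_single k]
  · simp [constraintNormal]
  · intro j _ hj
    simp [constraintNormal, Pi.single_eq_of_ne hj.symm]
  · simp

end

/-! ### Hilbert space model of the linearized scheme -/

open scoped InnerProductSpace InnerProduct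

/-- Every projection onto the range of an operator on a finite-dimensional space factors through
that operator. -/
theorem exists_factor_through {X V : Type*} [NormedAddCommGroup X] [NormedSpace ℝ X]
    [NormedAddCommGroup V] [NormedSpace ℝ V] [FiniteDimensional ℝ V] (S : V →L[ℝ] X)
    (P : X →L[ℝ] X) (hP : ∀ x, P x ∈ LinearMap.range S.toLinearMap) :
    ∃ R : X →L[ℝ] V, ∀ x, S (R x) = P x := by
  obtain ⟨g, hg⟩ := S.toLinearMap.rangeRestrict.exists_rightInverse_of_surjective
    (LinearMap.range_rangeRestrict _)
  refine ⟨g.toContinuousLinearMap.comp (P.codRestrict _ hP), fun x => ?_⟩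
  exact congrArg Subtype.val (LinearMap.congr_fun hg (P.codRestrict _ hP x))

section

variable {X : Type*} [NormedAddCommGroup X] [NormedSpace ℝ X] {H : Type*} [NormedAddCommGroup H]
  [InnerProductSpace ℝ H]

theorem adjoint_conj [CompleteSpace H] (e : X ≃L[ℝ] H) {b : X →L[ℝ] X →L[ℝ] ℝ}
    (he : ∀ x y, ⟪e x, e y⟫_ℝ = b x y) {A A' : X →L[ℝ] X}
    (h : ∀ w v, b (A' w) v = b w (A v)) :
    (e.conjContinuousAlgEquiv A)† = e.conjContinuousAlgEquiv A' := by
  refine ((ContinuousLinearMap.eq_adjoint_iff _ _).2 fun x y => ?_).symm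
  obtain ⟨x, rfl⟩ := e.surjective x
  obtain ⟨y, rfl⟩ := e.surjective y
  simp [he, h]

theorem isClosed_range_conj (e : X ≃L[ℝ] H) {A : X →L[ℝ] X} (hA : IsClosed (Set.range A)) :
    IsClosed (Set.range (e.conjContinuousAlgEquiv A)) := by
  have : Set.range (e.conjContinuousAlgEquiv A) = e '' Set.range A := by
    ext y
    constructor
    · rintro ⟨x, rfl⟩; exact ⟨_, ⟨e.symm x, rfl⟩, rfl⟩
    · rintro ⟨_, ⟨x, rfl⟩, rfl⟩; exact ⟨e x, by simp⟩
  rw [this]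
  exact e.toHomeomorph.isClosedMap _ hA

end

noncomputable section

universe w

variable {N K : ℕ} {E : Fin K → Type w} [∀ k, NormedAddCommGroup (E k)] [∀ k, NormedSpace ℝ (E k)]

theorem exists_norm_bounds_seminorm_comp {X H : Type*} [NormedAddCommGroup X] [NormedSpace ℝ X]
    [NormedAddCommGroup H] [NormedSpace ℝ H] (e : X ≃L[ℝ] H) {p : Seminorm ℝ H} {C : ℝ}
    (hC : 0 < C) (h1 : ∀ x, ‖x‖ ≤ p x) (h2 : ∀ x, p x ≤ C * ‖x‖) :
    ∃ c > 0, ∃ C > 0, (∀ x, c * ‖x‖ ≤ p (e x)) ∧ ∀ x, p (e x) ≤ C * ‖x‖ := by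
  refine ⟨1 / (‖(e.symm : H →L[ℝ] X)‖ + 1), by positivity,
    C * (‖(e : X →L[ℝ] H)‖ + 1), by positivity, fun x => ?_, fun x => ?_⟩
  · rw [div_mul_eq_mul_div, one_mul, div_le_iff₀ (by positivity)]
    have h4 := (e.symm : H →L[ℝ] X).le_opNorm (e x)
    simp only [ContinuousLinearEquiv.coe_coe, ContinuousLinearEquiv.symm_apply_apply] at h4
    have h5 : ‖e x‖ ≤ p (e x) := h1 _
    calc ‖x‖ ≤ ‖(e.symm : H →L[ℝ] X)‖ * p (e x) := h4.trans (by gcongr)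
      _ ≤ p (e x) * (‖(e.symm : H →L[ℝ] X)‖ + 1) := by
        nlinarith [apply_nonneg p (e x)]
  · have h4 : ‖e x‖ ≤ ‖(e : X →L[ℝ] H)‖ * ‖x‖ := (e : X →L[ℝ] H).le_opNorm x
    calc p (e x) ≤ C * ‖e x‖ := h2 _
      _ ≤ C * ((‖(e : X →L[ℝ] H)‖ + 1) * ‖x‖) := by
        gcongr; exact h4.trans (by gcongr; linarith)
      _ = _ := by ring

/-- The Hilbert space model of the linearized iteration: the self-adjoint projection `Q` onto the
constraints, the operator `A = M⁻¹ L₁` and its properties under the hypotheses of the theorem. -/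
theorem exists_hilbert_model [∀ k, CompleteSpace (E k)]
    {ι : ∀ k, E k →L[ℝ] L2 N} {M : ∀ k, E k ≃L[ℝ] StrongDual ℝ (E k)}
    (hMsymm : ∀ k a b, M k a b = M k b a) (hMpos : ∀ k a, a ≠ 0 → 0 < M k a a)
    {L00 : State E → CoState E} {μ : Fin K → ℝ} {u : State E}
    (hu : ∀ k, ip ι k (u k) ((M k).symm (toDual ι k (u k))) ≠ 0)
    (hfin : FiniteDimensional ℝ (LinearMap.ker (L1 ι L00 μ u).toLinearMap))
    (hran : IsClosed (Set.range (L1 ι L00 μ u)))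
    (horth : ∀ ψ, L1 ι L00 μ u ψ = 0 → ∀ k, ip ι k (u k) (ψ k) = 0)
    {m : Fin K → State E} (hm : ∀ k, L1 ι L00 μ u (m k) = Pi.single k (toDual ι k (u k)))
    (hdet : (Matrix.of fun i j => ip ι i (u i) (m j i)).det ≠ 0) :
    ∃ (H : Type w) (_ : NormedAddCommGroup H) (_ : InnerProductSpace ℝ H) (_ : CompleteSpace H)
      (e : State E ≃L[ℝ] H) (A Q P : H →L[ℝ] H), Q * Q = Q ∧ Q† = Q ∧
      (∀ x, Q (e x) = e (constraintProj ι M u x)) ∧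
      e.conjContinuousAlgEquiv (LPCV ι M L00 μ u) = -(Q * A† * Q * A) ∧
      (∀ x, A x = 0 → Q x = x) ∧ (∀ x, A (P x) = 0) ∧
      (∀ x, A (e x) = 0 ↔ L1 ι L00 μ u x = 0) ∧
      (∀ x g, A g = 0 → ⟪g, x - P x⟫_ℝ = 0) ∧
      ∃ c > 0, ∀ w, Q w = w → (∀ g, A g = 0 → ⟪g, w⟫_ℝ = 0) → c * ‖w‖ ≤ ‖Q (A w)‖ := by
  obtain ⟨c, hc, hcoer⟩ := exists_coercive_energyForm M hMsymm hMpos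
  have hfsymm : ∀ a b, energyForm M a b = energyForm M b a := fun a b => by
    simp only [energyForm_apply]
    exact Finset.sum_congr rfl fun k _ => hMsymm k _ _
  obtain ⟨H, _, _, _, e, he⟩ := exists_hilbert_of_coercive_form (energyForm M) hfsymm hc hcoer
  set q := constraintProj ι M u with hq
  set A₀ : State E →L[ℝ] State E := (Minv M).comp (L1 ι L00 μ u) with hA₀
  set A := e.conjContinuousAlgEquiv A₀ with hA
  set Q := e.conjContinuousAlgEquiv q with hQ
  have hMinv0 : ∀ f, Minv M f = 0 ↔ f = 0 := fun f => by
    constructor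
    · intro h
      ext1 k
      have := congrFun h k
      simpa [Minv] using this
    · rintro rfl; exact map_zero _
  have hAe : ∀ x, A (e x) = e (A₀ x) := fun x => by simp [hA]
  have hQe : ∀ x, Q (e x) = e (q x) := fun x => by simp [hQ]
  have hAker : ∀ x, A (e x) = 0 ↔ L1 ι L00 μ u x = 0 := fun x => by
    rw [hAe, e.map_eq_zero_iff]; exact hMinv0 _
  have hqq : q * q = q := by
    ext1 x
    exact constraintProj_eq_self fun k => ip_constraintProj hu x k
  have hQQ : Q * Q = Q := by rw [hQ, ← map_mul, hqq]
  have hQs : Q† = Q := adjoint_conj e he fun w v => energyForm_constraintProj hMsymm w v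
  have hAs : A† = e.conjContinuousAlgEquiv ((Minv M).comp (adj (L1 ι L00 μ u))) :=
    adjoint_conj e he fun w v => energyForm_Minv_adj M hMsymm _ w v
  have hkerQ : ∀ x, A x = 0 → Q x = x := by
    intro x hx
    obtain ⟨x, rfl⟩ := e.surjective x
    rw [hQe, constraintProj_eq_self (horth x ((hAker x).1 hx))]
  have hclosed : IsClosed (Set.range A) := by
    refine isClosed_range_conj e ?_
    have h1 : Set.range A₀ = (ContinuousLinearEquiv.piCongrRight fun k => (M k).symm) ''
        Set.range (L1 ι L00 μ u) := by
      rw [← Set.range_comp]; rfl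
    rw [h1]
    exact (ContinuousLinearEquiv.piCongrRight fun k => (M k).symm).toHomeomorph.isClosedMap _ hran
  let G := LinearMap.ker A.toLinearMap
  have hGmem : ∀ x, x ∈ G ↔ A x = 0 := fun x => LinearMap.mem_ker
  -- Finite dimension supplies the orthogonal projection onto the kernel.
  have : FiniteDimensional ℝ G := by
    have h1 : G = (LinearMap.ker (L1 ι L00 μ u).toLinearMap).map e.toLinearEquiv.toLinearMap := by
      ext y
      obtain ⟨x, rfl⟩ := e.surjective y
      rw [hGmem, hAker]
      constructor
      · intro h; exact ⟨x, h, rfl⟩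
      · rintro ⟨x', hx', h⟩
        rwa [← e.injective h]
    rw [h1]; infer_instance
  refine ⟨H, _, _, _, e, A, Q, G.starProjection, hQQ, hQs, hQe, ?_, hkerQ,
    fun x => (hGmem _).1 (G.starProjection_apply_mem x), hAker, fun x g hg =>
      G.inner_right_of_mem_orthogonal ((hGmem g).2 hg) (G.sub_starProjection_mem_orthogonal x), ?_⟩
  · rw [LPCV_eq, map_neg, map_mul, map_mul, map_mul, hAs]
  -- The constraint normals span the complement of the range of `Q`, and `A` maps `m k` to the
  -- `k`-th normal.
  · refine exists_lower_bound_of_isClosed_range (m := fun k => e (m k))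
      (f := fun k => e (constraintNormal ι M u k)) hclosed (fun k => ?_) (fun x => ?_)
      (fun k x hx => ?_) hkerQ ?_
    · rw [hAe, hA₀, ContinuousLinearMap.comp_apply, hm]
      congr 1
      ext1 j
      by_cases hj : j = k
      · subst hj; simp [Minv, constraintNormal]
      · simp [Minv, constraintNormal, Pi.single_eq_of_ne hj]
    · obtain ⟨x, rfl⟩ := e.surjective x
      exact ⟨fun k => (ip ι k (u k) ((M k).symm (toDual ι k (u k))))⁻¹ * ip ι k (u k) (x k),
        by rw [hQe, ← map_sub, hq, sub_constraintProj, map_sum]; simp only [map_smul]⟩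
    · obtain ⟨x, rfl⟩ := e.surjective x
      rw [he, energyForm_constraintNormal]
      rw [hQe] at hx
      exact (constraintProj_eq_self_iff hu x).1 (e.injective hx) k
    · simpa only [he, energyForm_constraintNormal] using hdet

/-- Conjugation preserves the spectrum, so the threshold `-2 / Λ_min` becomes `2 / ‖Q A Q‖²`. -/
theorem LambdaMin_eq {ι : ∀ k, E k →L[ℝ] L2 N} {M : ∀ k, E k ≃L[ℝ] StrongDual ℝ (E k)}
    {L00 : State E → CoState E} {μ : Fin K → ℝ} {u : State E} [Nontrivial (State E)] {H : Type*}
    [NormedAddCommGroup H] [InnerProductSpace ℝ H] [CompleteSpace H] (e : State E ≃L[ℝ] H)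
    {A Q : H →L[ℝ] H} (hQ : Q * Q = Q) (hQs : Q† = Q)
    (h : e.conjContinuousAlgEquiv (LPCV ι M L00 μ u) = -(Q * A† * Q * A)) :
    LambdaMin ι M L00 μ u = -‖Q * A * Q‖ ^ 2 := by
  have : Nontrivial H := e.symm.surjective.nontrivial
  rw [LambdaMin, ← AlgEquiv.spectrum_eq e.conjContinuousAlgEquiv, h]
  exact (isLeast_spectrum_neg_compression hQ hQs).csInf_eq

section

variable {ι : ∀ k, E k →L[ℝ] L2 N} {M : ∀ k, E k ≃L[ℝ] StrongDual ℝ (E k)}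
  {L00 : State E → CoState E} {μ : Fin K → ℝ} {u : State E} {H : Type*}
  [NormedAddCommGroup H] [InnerProductSpace ℝ H] [CompleteSpace H] {e : State E ≃L[ℝ] H}
  {A Q : H →L[ℝ] H}

/-- The linearized step on the constraints is a Richardson iteration. -/
theorem conj_step_apply (hQ : Q * Q = Q) (hQs : Q† = Q)
    (hLPCV : e.conjContinuousAlgEquiv (LPCV ι M L00 μ u) = -(Q * A† * Q * A))
    (hQe : ∀ x, Q (e x) = e (constraintProj ι M u x))
    (hu : ∀ k, ip ι k (u k) ((M k).symm (toDual ι k (u k))) ≠ 0)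
    {T : State E →L[ℝ] State E} {t : ℝ}
    (hT : ∀ x, (∀ k, ip ι k (u k) (x k) = 0) → T x = x + t • LPCV ι M L00 μ u x)
    (x : H) (hx : Q x = x) :
    e.conjContinuousAlgEquiv T x = x - t • ((Q * A * Q)†) ((Q * A * Q) x) := by
  obtain ⟨x, rfl⟩ := e.surjective x
  have h1 : ∀ k, ip ι k (u k) (x k) = 0 := by
    rw [hQe] at hx
    exact (constraintProj_eq_self_iff hu x).1 (e.injective hx)
  have h2 : e (LPCV ι M L00 μ u x) = -(Q * A† * Q * A) (e x) := by
    have := congrArg (fun f : H →L[ℝ] H => f (e x)) hLPCV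
    simpa using this
  have hBs : (Q * A * Q)† = Q * A† * Q := by
    rw [← ContinuousLinearMap.star_eq_adjoint, star_mul, star_mul,
      ContinuousLinearMap.star_eq_adjoint, ContinuousLinearMap.star_eq_adjoint, hQs, mul_assoc]
  have hQx : ∀ x, Q (Q x) = Q x := fun x => congrArg (fun f : H →L[ℝ] H => f x) hQ
  have h3 : e.conjContinuousAlgEquiv T (e x) = e (T x) := by simp
  rw [h3, hT x h1, map_add, map_smul, h2, hBs, smul_neg, ← sub_eq_add_neg]
  simp [hx, hQx]

end

/-! ### Contraction and growth of the linearized step -/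

/-- The linearized step contracts modulo the invariance modes if the time step is below the
threshold. -/
theorem exists_contraction [∀ k, CompleteSpace (E k)] [Nontrivial (State E)]
    {ι : ∀ k, E k →L[ℝ] L2 N}
    {M : ∀ k, E k ≃L[ℝ] StrongDual ℝ (E k)}
    (hMsymm : ∀ k a b, M k a b = M k b a) (hMpos : ∀ k a, a ≠ 0 → 0 < M k a a)
    {L00 : State E → CoState E} {μ : Fin K → ℝ} {u : State E}
    (hu : ∀ k, ip ι k (u k) ((M k).symm (toDual ι k (u k))) ≠ 0)
    (hran : IsClosed (Set.range (L1 ι L00 μ u)))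
    (horth : ∀ ψ, L1 ι L00 μ u ψ = 0 → ∀ k, ip ι k (u k) (ψ k) = 0)
    {m : Fin K → State E} (hm : ∀ k, L1 ι L00 μ u (m k) = Pi.single k (toDual ι k (u k)))
    (hdet : (Matrix.of fun i j => ip ι i (u i) (m j i)).det ≠ 0)
    {V : Type*} [NormedAddCommGroup V] [NormedSpace ℝ V] [FiniteDimensional ℝ V]
    {S : V →L[ℝ] State E}
    (hS : LinearMap.range S.toLinearMap = LinearMap.ker (L1 ι L00 μ u).toLinearMap)
    {T : State E →L[ℝ] State E} {t : ℝ} (ht : 0 < t)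
    (hTc : ∀ x k, ip ι k (u k) (T x k) = 0)
    (hT : ∀ x, (∀ k, ip ι k (u k) (x k) = 0) → T x = x + t • LPCV ι M L00 μ u x)
    (hΛ : t < -2 / LambdaMin ι M L00 μ u) :
    ∃ R : State E →L[ℝ] V, ∃ p : Seminorm ℝ (State E), ∃ c > 0, ∃ C > 0, ∃ q, 0 ≤ q ∧ q < 1 ∧
      (∀ x, c * ‖x‖ ≤ p x) ∧ (∀ x, p x ≤ C * ‖x‖) ∧
      ∀ x, p (T x - S (R (T x))) ≤ q * p x := by
  have hfin : FiniteDimensional ℝ (LinearMap.ker (L1 ι L00 μ u).toLinearMap) := by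
    rw [← hS]; infer_instance
  obtain ⟨H, _, _, _, e, A, Q, P, hQ, hQs, hQe, hLPCV, hker, hPA, hAe, hP, c, hc, hlow⟩ :=
    exists_hilbert_model hMsymm hMpos hu hfin hran horth hm hdet
  have hsmall : t * ‖Q * A * Q‖ ^ 2 < 2 := by
    rw [LambdaMin_eq e hQ hQs hLPCV, neg_div_neg_eq] at hΛ
    -- If the norm vanished, the threshold would read `2 / 0 = 0`, against `0 < t`.
    have h1 : 0 < ‖Q * A * Q‖ ^ 2 := by
      by_contra! h
      have h2 : ‖Q * A * Q‖ ^ 2 = 0 := le_antisymm h (sq_nonneg _)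
      rw [h2, div_zero] at hΛ
      linarith
    rwa [lt_div_iff₀ h1] at hΛ
  have hTQ : ∀ x, Q (e.conjContinuousAlgEquiv T x) = e.conjContinuousAlgEquiv T x := fun x => by
    rw [e.conjContinuousAlgEquiv_apply_apply, hQe, constraintProj_eq_self (hTc _)]
  obtain ⟨p, C, hC, q, hq0, hq1, h1, h2, h3⟩ := exists_seminorm_contraction hQ hQs hTQ ht
    (conj_step_apply hQ hQs hLPCV hQe hu hT) hker hPA hP hc hlow hsmall
  obtain ⟨R, hR⟩ := exists_factor_through S (e.symm.conjContinuousAlgEquiv P) (fun x => by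
    rw [hS, LinearMap.mem_ker]
    refine (hAe _).1 ?_
    simpa using hPA (e x))
  obtain ⟨c', hc', C', hC', h1', h2'⟩ := exists_norm_bounds_seminorm_comp e hC h1 h2
  refine ⟨R, p.comp (e : State E →ₗ[ℝ] H), c', hc', C', hC', q, hq0, hq1, h1', h2',
    fun x => ?_⟩
  · have h4 := h3 (e x)
    simp only [e.conjContinuousAlgEquiv_apply_apply, e.symm_apply_apply] at h4
    have h5 : p.comp (e : State E →ₗ[ℝ] H) (T x - S (R (T x))) =
        p (e (T x) - P (e (T x))) := by
      rw [hR, Seminorm.comp_apply]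
      congr 1
      simp
    rw [h5]; exact h4

open MeasureTheory in
-- Indicators of disjoint balls around integer points of an axis form an infinite orthogonal family.
theorem not_finiteDimensional_L2 {N : ℕ} (hN : 0 < N) :
    ¬ FiniteDimensional ℝ (L2 N) := by
  intro hfd
  let x : ℕ → EuclideanSpace ℝ (Fin N) := fun n => EuclideanSpace.single ⟨0, hN⟩ (n : ℝ)
  have hdisj : ∀ i j, i ≠ j → Disjoint (Metric.ball (x i) (1 / 2)) (Metric.ball (x j) (1 / 2)) := by
    intro i j hij
    refine Metric.ball_disjoint_ball ?_
    have h1 : dist (x i) (x j) = |(i : ℝ) - j| := by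
      simp [x, Real.dist_eq]
    have h2 : (1 : ℤ) ≤ |(i : ℤ) - j| := Int.one_le_abs (sub_ne_zero.2 (by exact_mod_cast hij))
    rw [h1]
    have h3 : ((1 : ℤ) : ℝ) ≤ ((|(i : ℤ) - j| : ℤ) : ℝ) := by exact_mod_cast h2
    push_cast at h3
    linarith
  have hfinite : ∀ n, volume (Metric.ball (x n) (1 / 2)) ≠ ⊤ := fun n => measure_ball_lt_top.ne
  let v : ℕ → L2 N := fun n => indicatorConstLp 2 measurableSet_ball (hfinite n) (1 : ℝ)
  have hinner : ∀ i j, inner ℝ (v i) (v j) =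
      volume.real (Metric.ball (x i) (1 / 2) ∩ Metric.ball (x j) (1 / 2)) := fun i j => by
    rw [L2.real_inner_indicatorConstLp_one_indicatorConstLp_one]
  have hli : LinearIndependent ℝ v := by
    refine linearIndependent_of_ne_zero_of_inner_eq_zero (fun i hi => ?_) fun i j hij => ?_
    · have h1 := hinner i i
      rw [hi, inner_zero_left, Set.inter_self, eq_comm, Measure.real, ENNReal.toReal_eq_zero_iff] at h1
      rcases h1 with h1 | h1
      · exact (Metric.measure_ball_pos volume (x i) (by norm_num)).ne' h1
      · exact hfinite i h1
    · change inner ℝ (v i) (v j) = 0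
      rw [hinner, (hdisj i j hij).inter_eq, measureReal_empty]
  exact (hli.finite).not_infinite inferInstance

/-- A finite-dimensional range is closed; being dense, it would be all of `L²`. -/
theorem not_finiteDimensional_state (hN : 0 < N) (hK : 0 < K) (ι : ∀ k, E k →L[ℝ] L2 N)
    (hιd : ∀ k, DenseRange (ι k)) : ¬ FiniteDimensional ℝ (State E) := by
  intro h
  refine not_finiteDimensional_L2 hN ?_
  let k : Fin K := ⟨0, hK⟩
  have h1 : FiniteDimensional ℝ (E k) :=
    FiniteDimensional.of_surjective (LinearMap.proj k : State E →ₗ[ℝ] E k)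
      (LinearMap.proj_surjective k)
  have h2 : IsClosed (LinearMap.range (ι k).toLinearMap : Set (L2 N)) :=
    Submodule.closed_of_finiteDimensional _
  have h3 : Function.Surjective (ι k) := by
    rw [← Set.range_eq_univ, ← (hιd k).closure_range]
    rw [LinearMap.coe_range] at h2
    exact h2.closure_eq.symm
  exact FiniteDimensional.of_surjective (ι k).toLinearMap h3

/-- The linearized step grows geometrically if the time step is above the threshold. -/
theorem exists_growth [∀ k, CompleteSpace (E k)] [Nontrivial (State E)]
    {ι : ∀ k, E k →L[ℝ] L2 N}
    (hinf : ¬ FiniteDimensional ℝ (State E)) {M : ∀ k, E k ≃L[ℝ] StrongDual ℝ (E k)}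
    (hMsymm : ∀ k a b, M k a b = M k b a) (hMpos : ∀ k a, a ≠ 0 → 0 < M k a a)
    {L00 : State E → CoState E} {μ : Fin K → ℝ} {u : State E}
    (hu : ∀ k, ip ι k (u k) ((M k).symm (toDual ι k (u k))) ≠ 0)
    (hfin : FiniteDimensional ℝ (LinearMap.ker (L1 ι L00 μ u).toLinearMap))
    (hran : IsClosed (Set.range (L1 ι L00 μ u)))
    (horth : ∀ ψ, L1 ι L00 μ u ψ = 0 → ∀ k, ip ι k (u k) (ψ k) = 0)
    {m : Fin K → State E} (hm : ∀ k, L1 ι L00 μ u (m k) = Pi.single k (toDual ι k (u k)))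
    (hdet : (Matrix.of fun i j => ip ι i (u i) (m j i)).det ≠ 0)
    {T : State E →L[ℝ] State E} {t : ℝ} (ht : 0 < t)
    (hTc : ∀ x k, ip ι k (u k) (T x k) = 0)
    (hT : ∀ x, (∀ k, ip ι k (u k) (x k) = 0) → T x = x + t • LPCV ι M L00 μ u x)
    (hΛ : -2 / LambdaMin ι M L00 μ u < t) :
    ∃ p : Seminorm ℝ (State E), ∃ c > 0, ∃ C > 0, ∃ ρ > 1,
      (∀ x, c * ‖x‖ ≤ p x) ∧ (∀ x, p x ≤ C * ‖x‖) ∧ (∀ x, p (T x) ≤ ρ * p x) ∧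
      ∀ n : ℕ, ∃ h, p h ≤ 1 ∧ 1 / 2 * ρ ^ n ≤ p ((T ^ n) h) := by
  obtain ⟨H, _, _, _, e, A, Q, P, hQ, hQs, hQe, hLPCV, hker, hPA, hAe, hP, c, hc, hlow⟩ :=
    exists_hilbert_model hMsymm hMpos hu hfin hran horth hm hdet
  have hQx : ∀ x, Q (Q x) = Q x := fun x => congrArg (fun f : H →L[ℝ] H => f x) hQ
  -- For `Q A Q = 0` the threshold would be `2 / 0 = 0` and the growth claim would fail. Coercivity
  -- then puts the range of `Q` into the kernel, so the space is the sum of the kernel and finitely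
  -- many normals, hence finite-dimensional.
  have hB0 : Q * A * Q ≠ 0 := by
    intro hB
    have h1 : ∀ x, constraintProj ι M u x ∈ LinearMap.ker (L1 ι L00 μ u).toLinearMap := by
      intro x
      set w := Q (e x) - P (Q (e x)) with hw
      have h2 : Q w = w := by rw [hw, map_sub, hQx, hker _ (hPA _)]
      have h3 : Q (A w) = 0 := by
        have := congrArg (fun f : H →L[ℝ] H => f w) hB
        simpa [h2] using this
      have h4 := hlow w h2 (hP _)
      rw [h3, norm_zero] at h4
      have h5 : w = 0 := norm_le_zero_iff.1 (by
        by_contra! h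
        have := mul_pos hc h
        linarith)
      rw [LinearMap.mem_ker]
      refine (hAe _).1 ?_
      rw [← hQe, sub_eq_zero.1 (hw.symm.trans h5)]
      exact hPA _
    have h2 : (⊤ : Submodule ℝ (State E)) ≤ Submodule.span ℝ (Set.range (constraintNormal ι M u)) ⊔
        LinearMap.ker (L1 ι L00 μ u).toLinearMap := by
      intro x _
      have h3 : x = (x - constraintProj ι M u x) + constraintProj ι M u x := by abel
      rw [h3]
      refine Submodule.add_mem_sup ?_ (h1 x)
      rw [sub_constraintProj]
      exact Submodule.sum_mem _ fun k _ => Submodule.smul_mem _ _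
        (Submodule.subset_span ⟨k, rfl⟩)
    have h3 : FiniteDimensional ℝ (Submodule.span ℝ (Set.range (constraintNormal ι M u))) :=
      FiniteDimensional.span_of_finite ℝ (Set.finite_range _)
    have h4 := Submodule.finiteDimensional_of_le h2
    exact hinf (Module.finite_def.2 ((Submodule.fg_iff_finiteDimensional _).2 h4))
  have hlarge : 2 < t * ‖Q * A * Q‖ ^ 2 := by
    rw [LambdaMin_eq e hQ hQs hLPCV, neg_div_neg_eq] at hΛ
    have h1 : 0 < ‖Q * A * Q‖ ^ 2 := by
      have := norm_pos_iff.2 hB0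
      positivity
    rwa [div_lt_iff₀ h1] at hΛ
  have hTQ : ∀ x, Q (e.conjContinuousAlgEquiv T x) = e.conjContinuousAlgEquiv T x := fun x => by
    rw [e.conjContinuousAlgEquiv_apply_apply, hQe, constraintProj_eq_self (hTc _)]
  obtain ⟨p, C, hC, ρ, hρ, h1, h2, h3, h4⟩ := exists_seminorm_growth hQ hQs hTQ ht
    (conj_step_apply hQ hQs hLPCV hQe hu hT) hlarge
  obtain ⟨c', hc', C', hC', h1', h2'⟩ := exists_norm_bounds_seminorm_comp e hC h1 h2
  refine ⟨p.comp (e : State E →ₗ[ℝ] H), c', hc', C', hC', ρ, hρ, h1', h2', fun x => ?_,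
    fun n => ?_⟩
  · simpa using h3 (e x)
  · obtain ⟨h, hh1, hh2⟩ := h4 n
    refine ⟨e.symm h, by simpa using hh1, ?_⟩
    rw [← map_pow, e.conjContinuousAlgEquiv_apply_apply] at hh2
    exact hh2

end

end PCSOM

/-! ### Remainders of products and compositions -/

section Calculus

variable {X Y Z : Type*} [NormedAddCommGroup X] [NormedSpace ℝ X] [NormedAddCommGroup Y]
  [NormedSpace ℝ Y] [NormedAddCommGroup Z] [NormedSpace ℝ Z]

theorem hasStrictFDerivAt_sub_smul_clm_apply {B : X → Y →L[ℝ] X} {g : X → Y} {x₀ : X}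
    (hB : ContDiffAt ℝ 1 B x₀) (hg : ContDiffAt ℝ 1 g x₀) (h0 : g x₀ = 0) (t : ℝ) :
    HasStrictFDerivAt (fun x => x - t • B x (g x)) (1 - t • (B x₀).comp (fderiv ℝ g x₀)) x₀ := by
  have h1 := ((hB.hasStrictFDerivAt (by norm_num)).clm_apply
    (hg.hasStrictFDerivAt (by norm_num))).const_smul t
  refine ((hasStrictFDerivAt_id x₀).sub h1).congr_fderiv ?_
  ext1 x
  simp [h0]

/-- The map need not be `C²`, since `B` is only `C¹`. As `g` vanishes at `x₀`, the variation of `B`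
enters multiplied by `g x = O(‖x - x₀‖)` and is still quadratic. -/
theorem isBigO_sub_smul_clm_apply {B : X → Y →L[ℝ] X} {g : X → Y} {x₀ : X}
    (hB : ContDiffAt ℝ 1 B x₀) (hg : ContDiffAt ℝ 2 g x₀) (h0 : g x₀ = 0) (t : ℝ) :
    (fun x => (x - t • B x (g x)) - x₀ - (1 - t • (B x₀).comp (fderiv ℝ g x₀)) (x - x₀))
      =O[𝓝 x₀] fun x => ‖x - x₀‖ ^ 2 := by
  have h1 : (fun x => B x - B x₀) =O[𝓝 x₀] fun x => ‖x - x₀‖ :=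
    (hB.differentiableAt (by norm_num)).hasFDerivAt.isBigO_sub.norm_right
  have h2 : g =O[𝓝 x₀] fun x => ‖x - x₀‖ := by
    have := (hg.differentiableAt (by norm_num)).hasFDerivAt.isBigO_sub.norm_right
    simpa [h0] using this
  have h3 := hg.exists_quadratic_remainder
  have h4 : (fun x => (B x - B x₀) (g x)) =O[𝓝 x₀] fun x => ‖x - x₀‖ ^ 2 := by
    have h5 : (fun x => (B x - B x₀) (g x)) =O[𝓝 x₀] fun x => ‖B x - B x₀‖ * ‖g x‖ :=
      Asymptotics.IsBigO.of_bound 1 (Eventually.of_forall fun x => by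
        rw [one_mul, norm_mul, norm_norm, norm_norm]; exact ContinuousLinearMap.le_opNorm _ _)
    simpa only [sq] using h5.trans (h1.norm_left.mul h2.norm_left)
  have h6 : (fun x => B x₀ (g x - fderiv ℝ g x₀ (x - x₀))) =O[𝓝 x₀] fun x => ‖x - x₀‖ ^ 2 := by
    refine ((B x₀).isBigO_comp _ _).trans ?_
    simpa [h0] using h3
  refine ((h4.add h6).const_smul_left (-t)).congr_left fun x => ?_
  simp
  module

theorem isBigO_comp_quadratic {f : X → Y} {g : Y → Z} {x₀ : X} {y₀ : Y} {f' : X →L[ℝ] Y}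
    (hf : (fun x => f x - y₀ - f' (x - x₀)) =O[𝓝 x₀] fun x => ‖x - x₀‖ ^ 2)
    (hfc : Tendsto f (𝓝 x₀) (𝓝 y₀)) (hg : ContDiffAt ℝ 2 g y₀) :
    (fun x => g (f x) - g y₀ - ((fderiv ℝ g y₀).comp f') (x - x₀))
      =O[𝓝 x₀] fun x => ‖x - x₀‖ ^ 2 := by
  have h1 : (fun x => f x - y₀) =O[𝓝 x₀] fun x => ‖x - x₀‖ := by
    have h2 : (fun x => ‖x - x₀‖ ^ 2) =O[𝓝 x₀] fun x => ‖x - x₀‖ := by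
      refine Asymptotics.IsBigO.of_bound 1 ?_
      filter_upwards [Metric.ball_mem_nhds x₀ one_pos] with x hx
      rw [Metric.mem_ball, dist_eq_norm] at hx
      rw [norm_pow, norm_norm, one_mul]
      nlinarith [norm_nonneg (x - x₀)]
    have h3 : (fun x => f' (x - x₀)) =O[𝓝 x₀] fun x => ‖x - x₀‖ :=
      (f'.isBigO_comp _ _).norm_right
    exact ((hf.trans h2).add h3).congr_left fun x => by simp
  have h4 := (hg.exists_quadratic_remainder.comp_tendsto hfc).trans
    (show _ =O[𝓝 x₀] fun x => ‖x - x₀‖ ^ 2 from (h1.norm_left.pow 2))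
  have h5 := ((fderiv ℝ g y₀).isBigO_comp _ _).trans hf
  refine (h4.add h5).congr_left fun x => ?_
  simp

end Calculus

/-! ### Smoothness and linearization of the scheme -/

namespace PCSOM

noncomputable section

variable {N K : ℕ} {E : Fin K → Type*} [∀ k, NormedAddCommGroup (E k)] [∀ k, NormedSpace ℝ (E k)]

/-- Writes operator families as sums of compositions with fixed embeddings, so that their smoothness
follows from that of composition. -/
theorem pi_eq_sum_single_comp {F : Fin K → Type*} [∀ k, NormedAddCommGroup (F k)]
    [∀ k, NormedSpace ℝ (F k)] {X : Type*} [NormedAddCommGroup X] [NormedSpace ℝ X]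
    (f : ∀ k, X →L[ℝ] F k) :
    ContinuousLinearMap.pi f = ∑ k, (ContinuousLinearMap.single ℝ F k).comp (f k) := by
  ext x k
  simp [Finset.sum_apply]

theorem contDiff_component (k : Fin K) {n : WithTop ℕ∞} :
    ContDiff ℝ n fun u : State E => u k :=
  (ContinuousLinearMap.proj k : State E →L[ℝ] E k).contDiff

theorem contDiff_adj {n : WithTop ℕ∞} :
    ContDiff ℝ n (adj : (State E →L[ℝ] CoState E) → State E →L[ℝ] CoState E) := by
  have h : (adj : (State E →L[ℝ] CoState E) → State E →L[ℝ] CoState E) = fun A =>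
      ∑ k, (ContinuousLinearMap.single ℝ (fun k => StrongDual ℝ (E k)) k).comp
        (∑ j, (ContinuousLinearMap.flipₗᵢ ℝ (E k) (E j) ℝ
          (((ContinuousLinearMap.proj j).comp A).comp (ContinuousLinearMap.single ℝ E k))).comp
            (ContinuousLinearMap.proj j)) := by
    funext A; rw [adj, pi_eq_sum_single_comp]; rfl
  rw [h]
  refine ContDiff.sum fun k _ => contDiff_const.clm_comp (ContDiff.sum fun j _ => ?_)
  refine ContDiff.clm_comp ?_ contDiff_const
  exact (LinearIsometryEquiv.contDiff _).comp
    ((contDiff_const.clm_comp contDiff_id).clm_comp contDiff_const)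

theorem contDiff_ip (ι : ∀ k, E k →L[ℝ] L2 N) (k : Fin K) {n : WithTop ℕ∞} {X : Type*}
    [NormedAddCommGroup X] [NormedSpace ℝ X] {f g : X → E k} (hf : ContDiff ℝ n f)
    (hg : ContDiff ℝ n g) : ContDiff ℝ n fun x => ip ι k (f x) (g x) :=
  ((ι k).contDiff.comp hf).inner ℝ ((ι k).contDiff.comp hg)

theorem contDiffAt_coeff {ι : ∀ k, E k →L[ℝ] L2 N} {M : ∀ k, E k ≃L[ℝ] StrongDual ℝ (E k)}
    {u : State E} (k : Fin K) (hu : ip ι k (u k) ((M k).symm (toDual ι k (u k))) ≠ 0)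
    {n : WithTop ℕ∞} : ContDiffAt ℝ n (fun v => coeff ι M v k) u := by
  have hk : ContDiff ℝ n fun v : State E => v k := contDiff_component k
  have h1 : ContDiff ℝ n fun v : State E => ip ι k (v k) ((M k).symm (toDual ι k (v k))) :=
    contDiff_ip ι k hk ((M k).symm.contDiff.comp ((toDual ι k).contDiff.comp hk))
  exact ((h1.contDiffAt.inv hu).smul ((toDual ι k).contDiff.comp hk).contDiffAt).clm_comp
    (contDiffAt_const (c := (ContinuousLinearMap.proj k).comp (Minv M)))

theorem contDiffAt_coeffDiag {ι : ∀ k, E k →L[ℝ] L2 N}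
    {M : ∀ k, E k ≃L[ℝ] StrongDual ℝ (E k)} {u : State E}
    (hu : ∀ k, ip ι k (u k) ((M k).symm (toDual ι k (u k))) ≠ 0) {n : WithTop ℕ∞} :
    ContDiffAt ℝ n (coeffDiag ι M) u := by
  have h : coeffDiag ι M = fun v => ∑ k,
      (ContinuousLinearMap.single ℝ (fun k => StrongDual ℝ (E k)) k).comp
        ((coeff ι M v k).smulRight (toDual ι k (v k))) := by
    funext v; rw [coeffDiag, pi_eq_sum_single_comp]
  rw [h]
  refine ContDiffAt.sum fun k _ => contDiffAt_const.clm_comp ?_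
  exact (contDiffAt_coeff k (hu k)).smulRight
    ((toDual ι k).contDiff.comp (contDiff_component k)).contDiffAt

theorem contDiff_diagOp (ι : ∀ k, E k →L[ℝ] L2 N) {n : WithTop ℕ∞} :
    ContDiff ℝ n (diagOp ι) := by
  have h : diagOp ι = fun μ => ∑ k,
      (ContinuousLinearMap.single ℝ (fun k => StrongDual ℝ (E k)) k).comp
        (μ k • (toDual ι k).comp (ContinuousLinearMap.proj k)) := by
    funext μ; rw [diagOp, pi_eq_sum_single_comp]
  rw [h]
  exact ContDiff.sum fun k _ => contDiff_const.clm_comp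
    ((contDiff_apply ℝ ℝ k).smul contDiff_const)

theorem contDiffAt_muOf {ι : ∀ k, E k →L[ℝ] L2 N} {M : ∀ k, E k ≃L[ℝ] StrongDual ℝ (E k)}
    {u : State E} (hu : ∀ k, ip ι k (u k) ((M k).symm (toDual ι k (u k))) ≠ 0)
    {L00 : State E → CoState E} {n : WithTop ℕ∞} (hL : ContDiffAt ℝ n L00 u) :
    ContDiffAt ℝ n (muOf ι M L00) u :=
  contDiffAt_pi.2 fun k => (contDiffAt_coeff k (hu k)).clm_apply hL

theorem L1_eq {ι : ∀ k, E k →L[ℝ] L2 N} {L00 : State E → CoState E} {u : State E}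
    (h : DifferentiableAt ℝ L00 u) (μ : Fin K → ℝ) :
    L1 ι L00 μ u = fderiv ℝ L00 u - diagOp ι μ :=
  (h.hasFDerivAt.sub (diagOp ι μ).hasFDerivAt).fderiv

theorem contDiffAt_L1 {ι : ∀ k, E k →L[ℝ] L2 N} {M : ∀ k, E k ≃L[ℝ] StrongDual ℝ (E k)}
    {u : State E} (hu : ∀ k, ip ι k (u k) ((M k).symm (toDual ι k (u k))) ≠ 0)
    {L00 : State E → CoState E} (hL : ContDiffAt ℝ 2 L00 u) :
    ContDiffAt ℝ 1 (fun v => L1 ι L00 (muOf ι M L00 v) v) u := by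
  have h1 : ContDiffAt ℝ 1 (fun v => fderiv ℝ L00 v - diagOp ι (muOf ι M L00 v)) u :=
    (hL.fderiv_right (by norm_num)).sub
      ((contDiff_diagOp ι).contDiffAt.comp u (contDiffAt_muOf hu (hL.of_le (by norm_num))))
  refine h1.congr_of_eventuallyEq ?_
  filter_upwards [hL.eventually (by norm_num)] with v hv
  exact L1_eq (hv.differentiableAt (by norm_num)) _

/-- The operator `f ↦ M⁻¹ Π L₁† M⁻¹ Π f` with `Π f = f - diag(a_1, …, a_K) u`, which turns
`L₀ u` into the increment of the scheme. -/
def incrementOp (ι : ∀ k, E k →L[ℝ] L2 N) (M : ∀ k, E k ≃L[ℝ] StrongDual ℝ (E k))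
    (L00 : State E → CoState E) (u : State E) : CoState E →L[ℝ] State E :=
  (Minv M).comp (((1 - coeffDiag ι M u).comp (adj (L1 ι L00 (muOf ι M L00 u) u))).comp
    ((Minv M).comp (1 - coeffDiag ι M u)))

theorem contDiffAt_incrementOp {ι : ∀ k, E k →L[ℝ] L2 N}
    {M : ∀ k, E k ≃L[ℝ] StrongDual ℝ (E k)}
    {u : State E} (hu : ∀ k, ip ι k (u k) ((M k).symm (toDual ι k (u k))) ≠ 0)
    {L00 : State E → CoState E} (hL : ContDiffAt ℝ 2 L00 u) :
    ContDiffAt ℝ 1 (incrementOp ι M L00) u := by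
  have h1 : ContDiffAt ℝ 1 (fun v => 1 - coeffDiag ι M v) u :=
    contDiffAt_const.sub (contDiffAt_coeffDiag hu)
  exact contDiffAt_const.clm_comp ((h1.clm_comp
    ((contDiff_adj (E := E)).contDiffAt.comp u (contDiffAt_L1 hu hL))).clm_comp
      (contDiffAt_const.clm_comp h1))

theorem coeff_diagOp {ι : ∀ k, E k →L[ℝ] L2 N} {M : ∀ k, E k ≃L[ℝ] StrongDual ℝ (E k)}
    {u : State E} {k : Fin K} (hu : ip ι k (u k) ((M k).symm (toDual ι k (u k))) ≠ 0)
    (μ : Fin K → ℝ) : coeff ι M u k (diagOp ι μ u) = μ k := by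
  simp only [coeff, diagOp, Minv, smul_apply, ContinuousLinearMap.comp_apply,
    ContinuousLinearMap.proj_apply, ContinuousLinearMap.coe_pi', ContinuousLinearEquiv.coe_coe,
    map_smul, smul_eq_mul, toDual_apply]
  field_simp

theorem coeffDiag_eq_diagOp (ι : ∀ k, E k →L[ℝ] L2 N) (M : ∀ k, E k ≃L[ℝ] StrongDual ℝ (E k))
    (u : State E) (f : CoState E) :
    coeffDiag ι M u f = diagOp ι (fun k => coeff ι M u k f) u := rfl

/-- The projection `f ↦ f - coeffDiag f` annihilates every `diag(μ) u`, so the iterate-dependent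
`muOf` may be replaced by any fixed `μ`. With the `μ` of the wave, the increment is an operator
applied to a map that vanishes at the wave. -/
theorem hatStep_eq {ι : ∀ k, E k →L[ℝ] L2 N} {M : ∀ k, E k ≃L[ℝ] StrongDual ℝ (E k)}
    {u : State E} (hu : ∀ k, ip ι k (u k) ((M k).symm (toDual ι k (u k))) ≠ 0)
    (L00 : State E → CoState E) (Δt : ℝ) (μ : Fin K → ℝ) :
    hatStep ι M L00 Δt u = u - Δt • incrementOp ι M L00 u (L0 ι L00 μ u) := by
  have h1 : L0 ι L00 (muOf ι M L00 u) u = (1 - coeffDiag ι M u) (L0 ι L00 μ u) := by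
    have h2 : coeffDiag ι M u (diagOp ι μ u) = diagOp ι μ u := by
      rw [coeffDiag_eq_diagOp]
      simp only [coeff_diagOp (hu _)]
    have h3 : (1 - coeffDiag ι M u) (L0 ι L00 μ u) =
        L0 ι L00 μ u - coeffDiag ι M u (L0 ι L00 μ u) := rfl
    have h5 : coeffDiag ι M u (L00 u) = diagOp ι (muOf ι M L00 u) u := rfl
    rw [h3, L0, L0, map_sub, h2, h5]
    abel
  have h4 : residual ι M L00 u - diagOp ι (gammaOf ι M L00 u) u =
      (1 - coeffDiag ι M u) (residual ι M L00 u) := rfl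
  rw [hatStep, h4, residual, h1]
  rfl

theorem muOf_eq {ι : ∀ k, E k →L[ℝ] L2 N} {M : ∀ k, E k ≃L[ℝ] StrongDual ℝ (E k)}
    {u : State E} (hu : ∀ k, ip ι k (u k) ((M k).symm (toDual ι k (u k))) ≠ 0)
    {L00 : State E → CoState E} {μ : Fin K → ℝ} (h : L0 ι L00 μ u = 0) :
    muOf ι M L00 u = μ := by
  funext k
  rw [muOf, sub_eq_zero.1 h, coeff_diagOp (hu k)]

theorem LPCV_apply_eq_incrementOp {ι : ∀ k, E k →L[ℝ] L2 N}
    {M : ∀ k, E k ≃L[ℝ] StrongDual ℝ (E k)} {u : State E}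
    (hu : ∀ k, ip ι k (u k) ((M k).symm (toDual ι k (u k))) ≠ 0)
    {L00 : State E → CoState E} {μ : Fin K → ℝ} (h : L0 ι L00 μ u = 0) (x : State E) :
    LPCV ι M L00 μ u x = -incrementOp ι M L00 u (L1 ι L00 μ u x) := by
  have h1 : ∀ f, (1 - coeffDiag ι M u) f = f - coeffDiag ι M u f := fun f => rfl
  rw [LPCV_eq, incrementOp, muOf_eq hu h]
  simp only [neg_apply, mul_apply_eq_comp, ContinuousLinearMap.comp_apply, h1,
    Minv_sub_coeffDiag]

/-- Rescaling of the components to the prescribed powers `P`. -/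
def rescale (ι : ∀ k, E k →L[ℝ] L2 N) (P : Fin K → ℝ) (y : State E) : State E :=
  fun k => √(P k / power ι y k) • y k

theorem step_eq_rescale (ι : ∀ k, E k →L[ℝ] L2 N) (M : ∀ k, E k ≃L[ℝ] StrongDual ℝ (E k))
    (L00 : State E → CoState E) (P : Fin K → ℝ) (Δt : ℝ) (u : State E) :
    step ι M L00 P Δt u = rescale ι P (hatStep ι M L00 Δt u) := rfl

/-- The linearization of the rescaling at a wave with the prescribed powers. -/
def rescaleDeriv (ι : ∀ k, E k →L[ℝ] L2 N) (u : State E) : State E →L[ℝ] State E :=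
  1 - ContinuousLinearMap.pi fun k => (((power ι u k)⁻¹ •
    (toDual ι k (u k)).comp (ContinuousLinearMap.proj k)).smulRight (u k))

theorem rescaleDeriv_apply (ι : ∀ k, E k →L[ℝ] L2 N) (u x : State E) (k : Fin K) :
    rescaleDeriv ι u x k = x k - ((power ι u k)⁻¹ * ip ι k (u k) (x k)) • u k := rfl

theorem ip_rescaleDeriv {ι : ∀ k, E k →L[ℝ] L2 N} {u : State E} (hP : ∀ k, power ι u k ≠ 0)
    (x : State E) (k : Fin K) : ip ι k (u k) (rescaleDeriv ι u x k) = 0 := by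
  have h := hP k
  rw [rescaleDeriv_apply, ← toDual_apply, map_sub, map_smul, toDual_apply, toDual_apply,
    smul_eq_mul]
  change ip ι k (u k) (x k) - (power ι u k)⁻¹ * ip ι k (u k) (x k) * power ι u k = 0
  field_simp
  ring

/-- Rescaling projects along `u_k` and `constraintProj` along `M_k⁻¹ u_k`, but onto the same
constraint space; there both are the identity. -/
theorem rescaleDeriv_eq_self {ι : ∀ k, E k →L[ℝ] L2 N} {u x : State E}
    (hx : ∀ k, ip ι k (u k) (x k) = 0) : rescaleDeriv ι u x = x := by
  ext1 k
  rw [rescaleDeriv_apply, hx k, mul_zero, zero_smul, sub_zero]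

theorem power_pos {ι : ∀ k, E k →L[ℝ] L2 N} (hι : ∀ k, Function.Injective (ι k)) {u : State E}
    {k : Fin K} (hu : u k ≠ 0) : 0 < power ι u k :=
  real_inner_self_pos.2 (by rwa [Ne, map_eq_zero_iff _ (hι k)])

theorem rescale_eq_self {ι : ∀ k, E k →L[ℝ] L2 N} {u : State E} (hP : ∀ k, power ι u k ≠ 0) :
    rescale ι (power ι u) u = u := by
  ext1 k
  rw [rescale, div_self (hP k), Real.sqrt_one, one_smul]

theorem contDiff_power (ι : ∀ k, E k →L[ℝ] L2 N) (k : Fin K) {n : WithTop ℕ∞} :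
    ContDiff ℝ n fun u : State E => power ι u k :=
  contDiff_ip ι k (contDiff_component k) (contDiff_component k)

theorem hasFDerivAt_power (ι : ∀ k, E k →L[ℝ] L2 N) (u : State E) (k : Fin K) :
    HasFDerivAt (fun u : State E => power ι u k)
      ((2 : ℝ) • (toDual ι k (u k)).comp (ContinuousLinearMap.proj k)) u := by
  have h1 : HasFDerivAt (fun u : State E => ι k (u k))
      ((ι k).comp (ContinuousLinearMap.proj k : State E →L[ℝ] E k)) u :=
    ((ι k).comp (ContinuousLinearMap.proj k : State E →L[ℝ] E k)).hasFDerivAt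
  refine (h1.inner ℝ h1).congr_fderiv ?_
  ext1 x
  simp only [ContinuousLinearMap.comp_apply, ContinuousLinearMap.prod_apply, fderivInnerCLM_apply,
    ContinuousLinearMap.proj_apply, smul_apply, toDual_apply, smul_eq_mul, ip]
  rw [real_inner_comm (ι k (u k)) (ι k (x k))]
  ring

theorem contDiffAt_rescale {ι : ∀ k, E k →L[ℝ] L2 N} {u : State E}
    (hP : ∀ k, power ι u k ≠ 0) {n : WithTop ℕ∞} :
    ContDiffAt ℝ n (rescale ι (power ι u)) u := by
  refine contDiffAt_pi.2 fun k => ContDiffAt.smul ?_ (contDiff_component k).contDiffAt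
  refine ContDiffAt.sqrt (contDiffAt_const.div (contDiff_power ι k).contDiffAt (hP k)) ?_
  rw [div_self (hP k)]; exact one_ne_zero

theorem fderiv_rescale {ι : ∀ k, E k →L[ℝ] L2 N} {u : State E} (hP : ∀ k, power ι u k ≠ 0) :
    fderiv ℝ (rescale ι (power ι u)) u = rescaleDeriv ι u := by
  refine HasFDerivAt.fderiv (hasFDerivAt_pi'.2 fun k => ?_)
  have h1 := ((hasDerivAt_inv (hP k)).comp_hasFDerivAt u
    (hasFDerivAt_power ι u k)).const_mul (power ι u k)
  have h2 := (h1.sqrt (by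
    change power ι u k * (power ι u k)⁻¹ ≠ 0
    rw [mul_inv_cancel₀ (hP k)]; exact one_ne_zero)).smul
    (ContinuousLinearMap.proj k : State E →L[ℝ] E k).hasFDerivAt
  refine (h2.congr_of_eventuallyEq (Eventually.of_forall fun x => ?_)).congr_fderiv ?_
  · simp [rescale, div_eq_mul_inv]
  · ext1 x
    have h := hP k
    have h3 : rescaleDeriv ι u x k = x k - ((power ι u k)⁻¹ * ip ι k (u k) (x k)) • u k := rfl
    simp only [ContinuousLinearMap.comp_apply, ContinuousLinearMap.proj_apply, h3]
    simp [mul_inv_cancel₀ h, toDual_apply]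
    rw [← sub_eq_add_neg]
    congr 2
    field_simp

end

/-! ### The step near a wave -/

noncomputable section

variable {N K : ℕ} {E : Fin K → Type*} [∀ k, NormedAddCommGroup (E k)] [∀ k, NormedSpace ℝ (E k)]

section Step

variable {ι : ∀ k, E k →L[ℝ] L2 N} {M : ∀ k, E k ≃L[ℝ] StrongDual ℝ (E k)}
  {L00 : State E → CoState E} {μ : Fin K → ℝ} {u : State E}

theorem eventually_ne_zero {κ : Type*} [Finite κ] {F : κ → Type*} [∀ k, NormedAddCommGroup (F k)]
    {u : ∀ k, F k} (hu : ∀ k, u k ≠ 0) : ∀ᶠ v in 𝓝 u, ∀ k, v k ≠ 0 :=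
  eventually_all.2 fun k => (continuous_apply k).continuousAt.eventually_ne (hu k)

theorem contDiffAt_L0 (hL : ContDiffAt ℝ 2 L00 u) : ContDiffAt ℝ 2 (L0 ι L00 μ) u :=
  hL.sub (diagOp ι μ).contDiff.contDiffAt

theorem hatStep_eventuallyEq (hι : ∀ k, Function.Injective (ι k))
    (hMpos : ∀ k a, a ≠ 0 → 0 < M k a a) (hu : ∀ k, u k ≠ 0) (Δt : ℝ) :
    hatStep ι M L00 Δt =ᶠ[𝓝 u] fun v => v - Δt • incrementOp ι M L00 v (L0 ι L00 μ v) := by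
  filter_upwards [eventually_ne_zero hu] with v hv
  exact hatStep_eq (fun k => (ip_Minv_toDual_pos ι hι M hMpos k (hv k)).ne') L00 Δt μ

theorem hatStep_eq_self (hι : ∀ k, Function.Injective (ι k))
    (hMpos : ∀ k a, a ≠ 0 → 0 < M k a a) (hu : ∀ k, u k ≠ 0) (h0 : L0 ι L00 μ u = 0) (Δt : ℝ) :
    hatStep ι M L00 Δt u = u := by
  rw [hatStep_eq (fun k => (ip_Minv_toDual_pos ι hι M hMpos k (hu k)).ne') L00 Δt μ, h0, map_zero,
    smul_zero, sub_zero]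

theorem step_eq_self (hι : ∀ k, Function.Injective (ι k))
    (hMpos : ∀ k a, a ≠ 0 → 0 < M k a a) (hu : ∀ k, u k ≠ 0) (h0 : L0 ι L00 μ u = 0) (Δt : ℝ) :
    step ι M L00 (power ι u) Δt u = u := by
  rw [step_eq_rescale, hatStep_eq_self hι hMpos hu h0,
    rescale_eq_self fun k => (power_pos hι (hu k)).ne']

/-- The linearization of the scheme at a wave. -/
def stepDeriv (ι : ∀ k, E k →L[ℝ] L2 N) (M : ∀ k, E k ≃L[ℝ] StrongDual ℝ (E k))
    (L00 : State E → CoState E) (μ : Fin K → ℝ) (Δt : ℝ) (u : State E) : State E →L[ℝ] State E :=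
  (rescaleDeriv ι u).comp (1 - Δt • (incrementOp ι M L00 u).comp (L1 ι L00 μ u))

theorem hasStrictFDerivAt_hatStep (hι : ∀ k, Function.Injective (ι k))
    (hMpos : ∀ k a, a ≠ 0 → 0 < M k a a) (hu : ∀ k, u k ≠ 0) (hL : ContDiffAt ℝ 2 L00 u)
    (h0 : L0 ι L00 μ u = 0) (Δt : ℝ) :
    HasStrictFDerivAt (hatStep ι M L00 Δt)
      (1 - Δt • (incrementOp ι M L00 u).comp (L1 ι L00 μ u)) u :=
  (hasStrictFDerivAt_sub_smul_clm_apply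
    (contDiffAt_incrementOp (fun k => (ip_Minv_toDual_pos ι hι M hMpos k (hu k)).ne') hL)
    ((contDiffAt_L0 hL).of_le (by norm_num)) h0 Δt).congr_of_eventuallyEq
      (hatStep_eventuallyEq hι hMpos hu Δt).symm

theorem hasStrictFDerivAt_step (hι : ∀ k, Function.Injective (ι k))
    (hMpos : ∀ k a, a ≠ 0 → 0 < M k a a) (hu : ∀ k, u k ≠ 0) (hL : ContDiffAt ℝ 2 L00 u)
    (h0 : L0 ι L00 μ u = 0) (Δt : ℝ) :
    HasStrictFDerivAt (step ι M L00 (power ι u) Δt) (stepDeriv ι M L00 μ Δt u) u := by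
  have hP : ∀ k, power ι u k ≠ 0 := fun k => (power_pos hι (hu k)).ne'
  have h1 : HasStrictFDerivAt (rescale ι (power ι u)) (rescaleDeriv ι u)
      (hatStep ι M L00 Δt u) := by
    rw [hatStep_eq_self hι hMpos hu h0, ← fderiv_rescale hP]
    exact (contDiffAt_rescale (n := 1) hP).hasStrictFDerivAt (by norm_num)
  exact h1.comp u (hasStrictFDerivAt_hatStep hι hMpos hu hL h0 Δt)

theorem isBigO_step_sub (hι : ∀ k, Function.Injective (ι k))
    (hMpos : ∀ k a, a ≠ 0 → 0 < M k a a) (hu : ∀ k, u k ≠ 0) (hL : ContDiffAt ℝ 2 L00 u)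
    (h0 : L0 ι L00 μ u = 0) (Δt : ℝ) :
    (fun v => step ι M L00 (power ι u) Δt v - u - stepDeriv ι M L00 μ Δt u (v - u))
      =O[𝓝 u] fun v => ‖v - u‖ ^ 2 := by
  have hP : ∀ k, power ι u k ≠ 0 := fun k => (power_pos hι (hu k)).ne'
  have h1 := isBigO_sub_smul_clm_apply
    (contDiffAt_incrementOp (fun k => (ip_Minv_toDual_pos ι hι M hMpos k (hu k)).ne') hL)
    (contDiffAt_L0 (μ := μ) hL) h0 Δt
  have h2 : (fun v => hatStep ι M L00 Δt v - u -
      (1 - Δt • (incrementOp ι M L00 u).comp (L1 ι L00 μ u)) (v - u))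
      =O[𝓝 u] fun v => ‖v - u‖ ^ 2 := by
    refine h1.congr' ?_ EventuallyEq.rfl
    filter_upwards [hatStep_eventuallyEq (μ := μ) (L00 := L00) hι hMpos hu Δt] with v hv
    rw [hv]; rfl
  have hc : Tendsto (hatStep ι M L00 Δt) (𝓝 u) (𝓝 u) := by
    have := (hasStrictFDerivAt_hatStep hι hMpos hu hL h0 Δt).continuousAt.tendsto
    rwa [hatStep_eq_self hι hMpos hu h0] at this
  have h3 := isBigO_comp_quadratic h2 hc (contDiffAt_rescale hP)
  rw [fderiv_rescale hP, rescale_eq_self hP] at h3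
  exact h3

theorem eventually_stepDefined (hι : ∀ k, Function.Injective (ι k))
    (hMpos : ∀ k a, a ≠ 0 → 0 < M k a a) (hu : ∀ k, u k ≠ 0) (hL : ContDiffAt ℝ 2 L00 u)
    (h0 : L0 ι L00 μ u = 0) (Δt : ℝ) : ∀ᶠ v in 𝓝 u, StepDefined ι M L00 Δt v := by
  have hc : Tendsto (hatStep ι M L00 Δt) (𝓝 u) (𝓝 u) := by
    have := (hasStrictFDerivAt_hatStep hι hMpos hu hL h0 Δt).continuousAt.tendsto
    rwa [hatStep_eq_self hι hMpos hu h0] at this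
  filter_upwards [hL.eventually (by norm_num), eventually_ne_zero hu,
    hc.eventually (eventually_ne_zero hu)] with v h1 h2 h3
  exact ⟨h1.differentiableAt (by norm_num), fun k => ⟨h2 k, h3 k⟩⟩

theorem ip_stepDeriv (hP : ∀ k, power ι u k ≠ 0) (Δt : ℝ) (x : State E) (k : Fin K) :
    ip ι k (u k) (stepDeriv ι M L00 μ Δt u x k) = 0 :=
  ip_rescaleDeriv hP _ k

/-- `𝓛_PCV` takes values in the constraint space, so to first order the rescaling leaves a
constrained step unchanged. -/
theorem stepDeriv_apply (hu : ∀ k, ip ι k (u k) ((M k).symm (toDual ι k (u k))) ≠ 0)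
    (h0 : L0 ι L00 μ u = 0) (Δt : ℝ) {x : State E} (hx : ∀ k, ip ι k (u k) (x k) = 0) :
    stepDeriv ι M L00 μ Δt u x = x + Δt • LPCV ι M L00 μ u x := by
  have h1 : stepDeriv ι M L00 μ Δt u x = rescaleDeriv ι u (x + Δt • LPCV ι M L00 μ u x) := by
    rw [LPCV_apply_eq_incrementOp hu h0, smul_neg, ← sub_eq_add_neg]; rfl
  rw [h1]
  refine rescaleDeriv_eq_self fun k => ?_
  have h2 : ip ι k (u k) (LPCV ι M L00 μ u x k) = 0 := by
    rw [LPCV_eq, mul_assoc, mul_assoc, neg_apply, mul_apply_eq_comp, ← map_neg]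
    exact ip_constraintProj hu _ k
  have h3 : (x + Δt • LPCV ι M L00 μ u x) k = x k + Δt • LPCV ι M L00 μ u x k := rfl
  rw [← toDual_apply] at h2 ⊢
  rw [h3, map_add, map_smul, h2, smul_zero, add_zero, toDual_apply, hx]

end Step

/-! ### The family of waves -/

section Family

variable {s : ℕ} {ι : ∀ k, E k →L[ℝ] L2 N} {L00 : State E → CoState E}
  {φ : (Fin K → ℝ) × (Fin s → ℝ) → State E} {U : Set ((Fin K → ℝ) × (Fin s → ℝ))}
  {μ : Fin K → ℝ} {c : Fin s → ℝ}

theorem contDiffAt_family_left (hU : IsOpen U) (hφ : ContDiffOn ℝ 1 φ U) (h : (μ, c) ∈ U) :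
    ContDiffAt ℝ 1 (fun ν => φ (ν, c)) μ :=
  ContDiffAt.comp μ (hφ.contDiffAt (hU.mem_nhds h)) (contDiffAt_id.prodMk contDiffAt_const)

theorem contDiffAt_family_right (hU : IsOpen U) (hφ : ContDiffOn ℝ 1 φ U) (h : (μ, c) ∈ U) :
    ContDiffAt ℝ 1 (fun d => φ (μ, d)) c :=
  ContDiffAt.comp c (hφ.contDiffAt (hU.mem_nhds h)) (contDiffAt_const.prodMk contDiffAt_id)

theorem powerJacobian_apply (hφ : DifferentiableAt ℝ (fun ν => φ (ν, c)) μ) (i j : Fin K) :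
    powerJacobian ι φ μ c i j = 2 * ip ι i (φ (μ, c) i)
      (fderiv ℝ (fun ν => φ (ν, c)) μ (Pi.single j 1) i) := by
  have h := (hasFDerivAt_power ι (φ (μ, c)) i).comp μ hφ.hasFDerivAt
  have h' : fderiv ℝ (fun ν => power ι (φ (ν, c)) i) μ = _ := h.fderiv
  rw [powerJacobian, Matrix.of_apply, h']
  rfl

/-- A vanishing component would give a zero row of the Jacobian. -/
theorem ne_zero_of_det_powerJacobian (hφ : DifferentiableAt ℝ (fun ν => φ (ν, c)) μ)
    (hD : (powerJacobian ι φ μ c).det ≠ 0) (k : Fin K) : φ (μ, c) k ≠ 0 := by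
  intro h
  refine hD (Matrix.det_eq_zero_of_row_eq_zero k fun j => ?_)
  rw [powerJacobian_apply hφ, h, ip, map_zero, inner_zero_left, mul_zero]

theorem L1_apply_deriv_left (hU : IsOpen U) (hφ : ContDiffOn ℝ 1 φ U) (h : (μ, c) ∈ U)
    (hsol : ∀ p ∈ U, L0 ι L00 p.1 (φ p) = 0) (hL : DifferentiableAt ℝ L00 (φ (μ, c)))
    (k : Fin K) :
    L1 ι L00 μ (φ (μ, c)) (fderiv ℝ (fun ν => φ (ν, c)) μ (Pi.single k 1)) =
      Pi.single k (toDual ι k (φ (μ, c) k)) := by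
  set e : Fin K → ℝ := Pi.single k 1 with he
  have hγ : HasDerivAt (fun t : ℝ => μ + t • e) e 0 := by
    simpa using ((hasDerivAt_id (0 : ℝ)).smul_const e).const_add μ
  have hφ' : HasDerivAt (fun t : ℝ => φ (μ + t • e, c))
      (fderiv ℝ (fun ν => φ (ν, c)) μ e) 0 := by
    have h1 : HasFDerivAt (fun ν => φ (ν, c)) (fderiv ℝ (fun ν => φ (ν, c)) μ)
        (μ + (0 : ℝ) • e) := by
      rw [zero_smul, add_zero]
      exact ((contDiffAt_family_left hU hφ h).differentiableAt (by norm_num)).hasFDerivAt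
    exact h1.comp_hasDerivAt (0 : ℝ) hγ
  have hφ0 : φ (μ + (0 : ℝ) • e, c) = φ (μ, c) := by rw [zero_smul, add_zero]
  have hleft : HasDerivAt (fun t : ℝ => L0 ι L00 μ (φ (μ + t • e, c)))
      (L1 ι L00 μ (φ (μ, c)) (fderiv ℝ (fun ν => φ (ν, c)) μ e)) 0 := by
    have h1 : HasFDerivAt (L0 ι L00 μ) (L1 ι L00 μ (φ (μ, c))) (φ (μ + (0 : ℝ) • e, c)) := by
      rw [hφ0]
      exact (hL.sub (diagOp ι μ).differentiableAt).hasFDerivAt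
    exact h1.comp_hasDerivAt (0 : ℝ) hφ'
  have hright : HasDerivAt (fun t : ℝ => t • diagOp ι e (φ (μ + t • e, c)))
      (diagOp ι e (φ (μ, c))) 0 := by
    have h1 := (hasDerivAt_id (0 : ℝ)).smul ((diagOp ι e).hasFDerivAt.comp_hasDerivAt (0 : ℝ) hφ')
    refine h1.congr_deriv ?_
    simp
  -- The wave equation at `μ + t e`, rewritten with `μ` fixed; differentiating both sides at `t = 0`
  -- gives the claim.
  have hev : (fun t : ℝ => L0 ι L00 μ (φ (μ + t • e, c))) =ᶠ[𝓝 0]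
      fun t : ℝ => t • diagOp ι e (φ (μ + t • e, c)) := by
    have hcont : ContinuousAt (fun t : ℝ => (μ + t • e, c)) 0 := by fun_prop
    have hmem : ∀ᶠ t : ℝ in 𝓝 0, (μ + t • e, c) ∈ U :=
      hcont.eventually_mem (hU.mem_nhds (by simpa using h))
    filter_upwards [hmem] with t ht
    have h1 := sub_eq_zero.1 (hsol _ ht)
    rw [L0, h1]
    ext1 j
    simp [diagOp, add_smul, mul_smul]
  rw [(hleft.congr_of_eventuallyEq hev.symm).unique hright]
  ext1 j
  by_cases hj : j = k
  · subst hj; simp [diagOp, he]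
  · simp [diagOp, he, Pi.single_eq_of_ne hj]

theorem L1_apply_deriv_right (hU : IsOpen U) (hφ : ContDiffOn ℝ 1 φ U) (h : (μ, c) ∈ U)
    (hsol : ∀ p ∈ U, L0 ι L00 p.1 (φ p) = 0) (hL : DifferentiableAt ℝ L00 (φ (μ, c)))
    (w : Fin s → ℝ) :
    L1 ι L00 μ (φ (μ, c)) (fderiv ℝ (fun d => φ (μ, d)) c w) = 0 := by
  have h1 : HasFDerivAt (L0 ι L00 μ) (L1 ι L00 μ (φ (μ, c))) (φ (μ, c)) :=
    (hL.sub (diagOp ι μ).differentiableAt).hasFDerivAt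
  have h2 := HasFDerivAt.comp c h1
    ((contDiffAt_family_right hU hφ h).differentiableAt (by norm_num)).hasFDerivAt
  have h3 : (fun d => L0 ι L00 μ (φ (μ, d))) =ᶠ[𝓝 c] fun _ => 0 := by
    have hcont : ContinuousAt (fun d : Fin s → ℝ => (μ, d)) c := by fun_prop
    filter_upwards [hcont.eventually_mem (hU.mem_nhds h)] with d hd
    exact hsol _ hd
  have h4 := (h2.congr_of_eventuallyEq h3.symm).unique (hasFDerivAt_const 0 c)
  exact congrArg (fun f : (Fin s → ℝ) →L[ℝ] CoState E => f w) h4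

/-- The powers do not change along the invariance parameters. -/
theorem eventually_power_eq (hU : IsOpen U) (hφ : ContDiffOn ℝ 1 φ U) (h : (μ, c) ∈ U)
    (hsol : ∀ p ∈ U, L0 ι L00 p.1 (φ p) = 0) (hL : ContDiffAt ℝ 2 L00 (φ (μ, c)))
    (horth : ∀ d, (μ, d) ∈ U → ∀ ψ, L1 ι L00 μ (φ (μ, d)) ψ = 0 →
      ∀ k, ip ι k (φ (μ, d) k) (ψ k) = 0) :
    ∀ᶠ d in 𝓝 c, (μ, d) ∈ U ∧ power ι (φ (μ, d)) = power ι (φ (μ, c)) := by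
  have hcont : ContinuousAt (fun d : Fin s → ℝ => (μ, d)) c := by fun_prop
  have h1 : ∀ᶠ d in 𝓝 c, (μ, d) ∈ U := hcont.eventually_mem (hU.mem_nhds h)
  have h2 : ∀ᶠ d in 𝓝 c, ContDiffAt ℝ 2 L00 (φ (μ, d)) :=
    (contDiffAt_family_right hU hφ h).continuousAt.eventually (hL.eventually (by norm_num))
  obtain ⟨r, hr, h3⟩ := Metric.eventually_nhds_iff_ball.1 (h1.and h2)
  filter_upwards [Metric.ball_mem_nhds c hr] with d hd
  refine ⟨(h3 d hd).1, funext fun k => ?_⟩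
  have hderiv : ∀ d ∈ Metric.ball c r,
      HasFDerivAt (fun d => power ι (φ (μ, d)) k) (0 : (Fin s → ℝ) →L[ℝ] ℝ) d := by
    intro d hd
    have h4 := (h3 d hd).1
    have h5 := HasFDerivAt.comp d (hasFDerivAt_power ι (φ (μ, d)) k)
      ((contDiffAt_family_right hU hφ h4).differentiableAt (by norm_num)).hasFDerivAt
    refine h5.congr_fderiv ?_
    ext1 w
    -- The derivative in `d` lies in the kernel at the nearby wave; orthogonality there, not only at
    -- `c`, makes the power locally constant.
    have h6 := horth d h4 _ (L1_apply_deriv_right hU hφ h4 hsol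
      ((h3 d hd).2.differentiableAt (by norm_num)) w) k
    have h7 : ((2 : ℝ) • (toDual ι k (φ (μ, d) k)).comp (ContinuousLinearMap.proj k)).comp
        (fderiv ℝ (fun d => φ (μ, d)) d) w =
        2 * ip ι k (φ (μ, d) k) (fderiv ℝ (fun d => φ (μ, d)) d w k) := rfl
    rw [h7, h6, mul_zero]; rfl
  exact Metric.isOpen_ball.is_const_of_fderiv_eq_zero (convex_ball c r).isPreconnected
    (fun d hd => (hderiv d hd).differentiableAt.differentiableWithinAt)
    (fun d hd => (hderiv d hd).fderiv) hd (Metric.mem_ball_self hr)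

theorem range_fderiv_eq_span_mode (φ : (Fin K → ℝ) × (Fin s → ℝ) → State E) (μ : Fin K → ℝ)
    (c : Fin s → ℝ) :
    LinearMap.range (fderiv ℝ (fun d => φ (μ, d)) c).toLinearMap =
      Submodule.span ℝ (Set.range (mode φ μ c)) := by
  rw [LinearMap.range_eq_map, ← (Pi.basisFun ℝ (Fin s)).span_eq, Submodule.map_span,
    ← Set.range_comp]
  congr 2
  funext j
  simp [mode]

end Family

end

end PCSOM

/-! ### Proof of the convergence theorem -/

open PCSOM
theorem theorem4 {N K s : ℕ} (hN : 0 < N) (hK : 0 < K)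
    -- the energy spaces, embedded continuously and densely in `L²(ℝ^N)`
    {E : Fin K → Type*} [∀ k, NormedAddCommGroup (E k)] [∀ k, NormedSpace ℝ (E k)]
    [∀ k, CompleteSpace (E k)]
    (ι : ∀ k, E k →L[ℝ] L2 N) (hι : ∀ k, Function.Injective (ι k))
    (hιd : ∀ k, DenseRange (ι k))
    -- the Hermitian and positive definite acceleration operator `M = diag(M_1, …, M_K)`
    (M : ∀ k, E k ≃L[ℝ] StrongDual ℝ (E k)) (hMsymm : ∀ k a b, M k a b = M k b a)
    (hMpos : ∀ k a, a ≠ 0 → 0 < M k a a)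
    -- the family `φ (μ, c)` of solitary waves, with independent propagation constants `μ` and
    -- with the free parameters `c` of the general solution
    (L00 : State E → CoState E) (φ : (Fin K → ℝ) × (Fin s → ℝ) → State E)
    (U : Set ((Fin K → ℝ) × (Fin s → ℝ))) (hU : IsOpen U) (hφ : ContDiffOn ℝ 1 φ U)
    (hsol : ∀ p ∈ U, L0 ι L00 p.1 (φ p) = 0)
    -- the solitary wave `u = φ (μ, c)` under consideration
    (μ : Fin K → ℝ) (c : Fin s → ℝ) (hμc : (μ, c) ∈ U)
    (hL00 : ContDiffAt ℝ 2 L00 (φ (μ, c)))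
    -- the kernel of `L₁` consists of the invariance modes, and the range of `L₁` is closed
    (hker : LinearMap.ker (L1 ι L00 μ (φ (μ, c))).toLinearMap =
      Submodule.span ℝ (Set.range (mode φ μ c)))
    (hran : IsClosed (Set.range (L1 ι L00 μ (φ (μ, c)))))
    -- the solitary waves are orthogonal to the kernel of `L₁`, component by component
    (horth : ∀ d, (μ, d) ∈ U → ∀ ψ, L1 ι L00 μ (φ (μ, d)) ψ = 0 →
      ∀ k, ip ι k (φ (μ, d) k) (ψ k) = 0)
    (hD : (powerJacobian ι φ μ c).det ≠ 0)
    (Δt : ℝ) (hΔt : 0 < Δt) :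
    -- convergence
    (Δt < -2 / LambdaMin ι M L00 μ (φ (μ, c)) →
      ∀ ε > 0, ∃ δ > 0, ∀ u₀ : State E, ‖u₀ - φ (μ, c)‖ < δ →
        (∀ n, StepDefined ι M L00 Δt (iter ι M L00 (power ι (φ (μ, c))) Δt u₀ n)) ∧
        (∀ n, ‖iter ι M L00 (power ι (φ (μ, c))) Δt u₀ n - φ (μ, c)‖ < ε) ∧
        ∃ d, ‖d - c‖ < ε ∧ (μ, d) ∈ U ∧ power ι (φ (μ, d)) = power ι (φ (μ, c)) ∧
          Tendsto (iter ι M L00 (power ι (φ (μ, c))) Δt u₀) atTop (𝓝 (φ (μ, d)))) ∧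
    -- divergence
    (-2 / LambdaMin ι M L00 μ (φ (μ, c)) < Δt →
      ∃ ε > 0, ∀ δ > 0, ∃ u₀ : State E, ‖u₀ - φ (μ, c)‖ < δ ∧
        ∃ n, (∀ m < n, StepDefined ι M L00 Δt (iter ι M L00 (power ι (φ (μ, c))) Δt u₀ m)) ∧
          ε ≤ ‖iter ι M L00 (power ι (φ (μ, c))) Δt u₀ n - φ (μ, c)‖) := by
  have hφl : DifferentiableAt ℝ (fun ν => φ (ν, c)) μ :=
    (contDiffAt_family_left hU hφ hμc).differentiableAt (by norm_num)
  have hu : ∀ k, φ (μ, c) k ≠ 0 := ne_zero_of_det_powerJacobian hφl hD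
  have hu' : ∀ k, ip ι k (φ (μ, c) k) ((M k).symm (toDual ι k (φ (μ, c) k))) ≠ 0 := fun k =>
    (ip_Minv_toDual_pos ι hι M hMpos k (hu k)).ne'
  have hP : ∀ k, power ι (φ (μ, c)) k ≠ 0 := fun k => (power_pos hι (hu k)).ne'
  have h0 : L0 ι L00 μ (φ (μ, c)) = 0 := hsol _ hμc
  have : Nontrivial (State E) :=
    ⟨φ (μ, c), 0, fun h => hu ⟨0, hK⟩ (congrFun h _)⟩
  have hLd : DifferentiableAt ℝ L00 (φ (μ, c)) := hL00.differentiableAt (by norm_num)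
  have hm := L1_apply_deriv_left hU hφ hμc hsol hLd
  have hdet : (Matrix.of fun i j => ip ι i (φ (μ, c) i)
      (fderiv ℝ (fun ν => φ (ν, c)) μ (Pi.single j 1) i)).det ≠ 0 := by
    have h1 : powerJacobian ι φ μ c = (2 : ℝ) • Matrix.of fun i j => ip ι i (φ (μ, c) i)
        (fderiv ℝ (fun ν => φ (ν, c)) μ (Pi.single j 1) i) := by
      ext i j
      rw [powerJacobian_apply hφl]; rfl
    rw [h1, Matrix.det_smul] at hD
    exact right_ne_zero_of_mul hD
  have hS : LinearMap.range (fderiv ℝ (fun d => φ (μ, d)) c).toLinearMap =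
      LinearMap.ker (L1 ι L00 μ (φ (μ, c))).toLinearMap := by
    rw [hker, range_fderiv_eq_span_mode]
  have hTc := ip_stepDeriv (M := M) (L00 := L00) (μ := μ) hP Δt
  have hT := fun x hx => stepDeriv_apply hu' h0 Δt (x := x) hx
  obtain ⟨r, hr, hdef⟩ := Metric.eventually_nhds_iff.1
    (eventually_stepDefined hι hMpos hu hL00 h0 Δt)
  refine ⟨fun hΛ ε hε => ?_, fun hΛ => ?_⟩
  · obtain ⟨R, p, c₁, hc₁, c₂, hc₂, q, hq0, hq1, hlow, hup, hcontr⟩ :=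
      exists_contraction hMsymm hMpos hu' hran (horth c hμc) hm hdet hS hΔt hTc hT hΛ
    have hpow := eventually_power_eq hU hφ hμc hsol hL00 horth
    -- Neighbouring waves have the prescribed powers, so the same rescaling fixes them.
    have hfix : ∀ᶠ d in 𝓝 c, step ι M L00 (power ι (φ (μ, c))) Δt (φ (μ, d)) = φ (μ, d) := by
      filter_upwards [hpow, (contDiffAt_family_right hU hφ hμc).continuousAt.eventually
        (eventually_ne_zero hu)] with d hd hne
      rw [← hd.2]
      exact step_eq_self hι hMpos hne (hsol _ hd.1) Δt
    obtain ⟨r', hr', hpow⟩ := Metric.eventually_nhds_iff.1 hpow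
    obtain ⟨δ, hδ, hconv⟩ := iterate_tendsto_fixed_manifold (σ := fun d => φ (μ, d)) (v₀ := c) R
      (hasStrictFDerivAt_step hι hMpos hu hL00 h0 Δt)
      ((contDiffAt_family_right hU hφ hμc).hasStrictFDerivAt (by norm_num)) hfix p hc₁ hc₂.le
      -- Radius `r` keeps the iterates where the step is defined, and `r'` keeps the limit parameter
      -- where the powers agree.
      hlow hup hq0 hq1 hcontr (ε := min ε (min r r')) (by positivity)
    refine ⟨δ, hδ, fun u₀ hu₀ => ?_⟩
    obtain ⟨h1, d, hd, h2⟩ := hconv u₀ hu₀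
    obtain ⟨hdU, hdP⟩ := hpow (y := d) (by
      rw [dist_eq_norm]; exact hd.trans_le ((min_le_right _ _).trans (min_le_right _ _)))
    refine ⟨fun n => hdef ?_, fun n => (h1 n).trans_le (min_le_left _ _), d,
      hd.trans_le (min_le_left _ _), hdU, hdP, h2⟩
    rw [dist_eq_norm]
    exact (h1 n).trans_le ((min_le_right _ _).trans (min_le_left _ _))
  · have hfin : FiniteDimensional ℝ (LinearMap.ker (L1 ι L00 μ (φ (μ, c))).toLinearMap) := by
      rw [← hS]; infer_instance
    obtain ⟨p, c₁, hc₁, c₂, hc₂, ρ, hρ, hlow, hup, hTρ, hgrow⟩ :=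
      exists_growth (not_finiteDimensional_state hN hK ι hιd) hMsymm hMpos hu' hfin hran
        (horth c hμc) hm hdet hΔt hTc hT hΛ
    obtain ⟨C, hC, hquad⟩ := (isBigO_step_sub hι hMpos hu hL00 h0 Δt).exists_pos
    obtain ⟨r', hr', hquad⟩ := Metric.eventually_nhds_iff.1 hquad.bound
    -- The exit radius is at most `r`, so every iterate before the exit is one at which the step is
    -- defined.
    obtain ⟨ε, hε, hεr, hfar⟩ := exists_iterate_far (F := step ι M L00 (power ι (φ (μ, c))) Δt)
      (x₀ := φ (μ, c)) (C := C) (r := min r r') (by positivity) hC.le hρ one_half_pos p hc₁ hc₂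
      hlow hup (fun x hx => by
        have := hquad (y := x) (by rw [dist_eq_norm]; exact hx.trans_le (min_le_right _ _))
        simpa using this) hTρ hgrow
    refine ⟨ε, hε, fun δ hδ => ?_⟩
    obtain ⟨x, hx, n, hn1, hn2⟩ := hfar δ hδ
    refine ⟨x, hx, n, fun m hmn => hdef ?_, hn2⟩
    rw [dist_eq_norm]
    exact (hn1 m hmn).trans_le (hεr.trans (min_le_left _ _))
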